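/- Let $d\ge 2$ be an integer and $\gamma>d$ real. Let $\mu_d$ be the measure on the space $\mathcal L^d$ of lines of $\mathbb R^d$ that is invariant under Euclidean isometries, normalized so that the lines hitting a flat piece of hypersurface have measure equal to its $(d-1)$-dimensional area. Let $\Pi$ be a Poisson point process on $\mathcal L^d\times(0,\infty)$ with intensity measure $(\gamma-1)v^{-\gamma}\,\mathrm dv\,\mu_d(\mathrm d\ell)$; its points $(\ell,v)$ are lines $\ell$ marked by speed-limits $v$. For $v>0$ let $\mathcal S_v$ be the union of all lines $\ell$ with $(\ell,w)\in\Pi$ for some $w\ge v$. A $\Pi$-path on $[0,T]$, with $0\le T<\infty$, is a Lipschitz map $\xi:[0,T]\to\mathbb R^d$ such that for every $v>0$ the set $\{t\in[0,T]: |\xi'(t)|>v,\ \xi(t)\notin\mathcal S_v\}$ is Lebesgue-null; it connects $\xi(0)$ to $\xi(T)$ in time $T$. It is a $\Pi$-geodesic if no $\Pi$-path connects $\xi(0)$ to $\xi(T)$ in a time $S<T$. Let $\tau(x,y)\in[0,\infty]$ be the infimum of the times in which $\Pi$-paths connect $x$ to $y$. Then, almost surely, simultaneously for all $x,y\in\mathbb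 R^d$: 1. $x$ and $y$ are connected by a $\Pi$-path in finite time; 2. $\tau$ is a (finite) metric on $\mathbb R^d$, and $(\mathbb R^d,\tau)$ is a geodesic metric space; 3. there is a $\Pi$-geodesic from $x$ to $y$, and every $\Pi$-geodesic $\xi:[0,T]\to\mathbb R^d$ from $x$ to $y$ is a geodesic of this metric space: $\tau(\xi(s),\xi(t))=|s-t|$ for all $s,t\in[0,T]$ (in particular $T=\tau(x,y)$). Moreover the metric is random: for all fixed $x,y\in\mathbb R^d$, $\tau(x,y)$ is a random variable (it agrees almost surely with a measurable function on the probability space). -/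

import Mathlib

open MeasureTheory ProbabilityTheory Set
open scoped NNReal ENNReal

/-! ### Lines and the invariant line measure -/

/-- The Euclidean space `ℝᵈ`. -/
abbrev Space (d : ℕ) : Type := EuclideanSpace ℝ (Fin d)

/-- The unit sphere of `ℝᵈ`. -/
abbrev Directions (d : ℕ) : Type := Metric.sphere (0 : Space d) 1

/-- Line-space: the set of all (un-sensed) lines of `ℝᵈ`, that is, of its one-dimensional affine
subspaces. -/
def Line (d : ℕ) : Type :=
  {l : AffineSubspace ℝ (Space d) // Module.finrank ℝ l.direction = 1}

namespace Line

variable {d : ℕ}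

/-- The set of points of a line. -/
def points (l : Line d) : Set (Space d) := (l.1 : Set (Space d))

/-- The line through the point `x` in the direction of the unit vector `u`. -/
noncomputable def through (x : Space d) (u : Directions d) : Line d :=
  ⟨AffineSubspace.mk' x (Submodule.span ℝ {(u : Space d)}), by
    rw [AffineSubspace.direction_mk']
    exact finrank_span_singleton (ne_zero_of_mem_unit_sphere u)⟩

theorem mem_points_through {x y : Space d} {u : Directions d} :
    y ∈ (through x u).points ↔ ∃ r : ℝ, y = x + r • (u : Space d) := by
  simp only [points, through, SetLike.mem_coe, AffineSubspace.mem_mk', vsub_eq_sub,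
    Submodule.mem_span_singleton]
  constructor
  · rintro ⟨r, hr⟩
    exact ⟨r, by rw [hr]; abel⟩
  · rintro ⟨r, rfl⟩
    exact ⟨r, by abel⟩

theorem through_add_smul (x : Space d) (u : Directions d) {w : Space d}
    (hw : w ∈ Submodule.span ℝ {(u : Space d)}) : through (w + x) u = through x u := by
  apply Subtype.ext
  apply SetLike.ext
  intro y
  simp only [through, AffineSubspace.mem_mk', vsub_eq_sub]
  rw [show y - (w + x) = (y - x) - w by abel]
  exact Submodule.sub_mem_iff_left _ hw

/-- Line-space is the quotient of `ℝᵈ × S^{d-1}` under `(x, u) ↦ (the line x + ℝ u)`, and carries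
the quotient (Borel) σ-algebra. -/
noncomputable instance : MeasurableSpace (Line d) :=
  MeasurableSpace.map (fun p : Space d × Directions d => through p.1 p.2) inferInstance

theorem measurable_through :
    Measurable (fun p : Space d × Directions d => through p.1 p.2) :=
  measurable_iff_le_map.2 le_rfl

end Line

/-- The volume `κ_{d-1}` of the unit ball of `ℝ^{d-1}`. -/
noncomputable def kappaPred (d : ℕ) : ℝ≥0∞ :=
  volume (Metric.ball (0 : EuclideanSpace ℝ (Fin (d - 1))) 1)

/-- The invariant measure `μ_d` on line-space: up to the factor `1 / (2 κ_{d-1})`, the image under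
`(x, u) ↦ x + ℝ u` of Lebesgue measure times surface measure, restricted to the slabs
`0 ≤ ⟪x, u⟫ ≤ 1`. The slab has unit thickness in the direction `u`, so that for fixed `u` one gets
`(d-1)`-dimensional Lebesgue measure on the hyperplane orthogonal to `u`: see `lineMeasure_apply`.
The factor makes the measure of the lines hitting a flat piece of hypersurface equal to its
`(d-1)`-dimensional area (each line is counted for `u` and for `-u`). -/
noncomputable def lineMeasure (d : ℕ) : Measure (Line d) :=
  (2 * kappaPred d)⁻¹ • Measure.map (fun p : Space d × Directions d => Line.through p.1 p.2)
    (((volume : Measure (Space d)).prod (volume : Measure (Space d)).toSphere).restrict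
      {p | inner ℝ p.1 (p.2 : Space d) ∈ Icc (0 : ℝ) 1})

/-- For unit `u`, a cylinder `A` along `u` meets the slab `0 ≤ ⟪x, u⟫ ≤ 1` in a set whose volume is
the `(d-1)`-dimensional volume of the orthogonal cross-section of `A`. -/
theorem volume_inter_slab {d : ℕ} (u : Space d) (hu : ‖u‖ = 1) (A : Set (Space d))
    (hinv : ∀ w ∈ Submodule.span ℝ {u}, ∀ y, w + y ∈ A ↔ y ∈ A) :
    volume (A ∩ {x | inner ℝ x u ∈ Icc (0 : ℝ) 1}) =
      volume {y : (Submodule.span ℝ {u})ᗮ | (y : Space d) ∈ A} := by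
  have hmp := (Submodule.span ℝ {u}).measurePreserving_measurableEquivProd (0 : Space d)
  rw [InnerProductSpace.euclideanHausdorffMeasure_eq_volume] at hmp
  rw [← hmp.symm.measure_preimage_equiv]
  have hset : ((Submodule.span ℝ {u}).measurableEquivProd (0 : Space d)).symm ⁻¹'
      (A ∩ {x | inner ℝ x u ∈ Icc (0 : ℝ) 1}) =
      {w : Submodule.span ℝ {u} | inner ℝ (w : Space d) u ∈ Icc (0 : ℝ) 1} ×ˢ
        {y : (Submodule.span ℝ {u})ᗮ | (y : Space d) ∈ A} := by
    ext ⟨w, y⟩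
    have h1 := hinv w w.2 y
    have h2 : inner ℝ (y : Space d) u = 0 :=
      Submodule.inner_left_of_mem_orthogonal (Submodule.mem_span_singleton_self _) y.2
    simp only [mem_preimage, mem_inter_iff, mem_ofPred_eq, mem_prod,
      Submodule.measurableEquivProd_symm_apply, vadd_eq_add, add_zero, h1, inner_add_left, h2]
    exact and_comm
  rw [hset, Measure.volume_eq_prod, Measure.prod_prod]
  have hone : volume {w : Submodule.span ℝ {u} | inner ℝ (w : Space d) u ∈ Icc (0 : ℝ) 1} = 1 := by
    have hmp2 := (LinearIsometryEquiv.toSpanUnitSingleton (𝕜 := ℝ) u hu).measurePreserving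
    have hI : MeasurableSet {w : Submodule.span ℝ {u} |
        inner ℝ (w : Space d) u ∈ Icc (0 : ℝ) 1} := by
      have hc : Measurable (fun w : Submodule.span ℝ {u} => inner ℝ (w : Space d) u) :=
        (continuous_subtype_val.inner continuous_const).measurable
      exact hc measurableSet_Icc
    rw [← hmp2.measure_preimage hI.nullMeasurableSet]
    have hIcc : (LinearIsometryEquiv.toSpanUnitSingleton (𝕜 := ℝ) u hu) ⁻¹'
        {w : Submodule.span ℝ {u} | inner ℝ (w : Space d) u ∈ Icc (0 : ℝ) 1} = Icc (0 : ℝ) 1 := by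
      ext r
      simp [real_inner_smul_left, hu]
    rw [hIcc, Real.volume_Icc, sub_zero, ENNReal.ofReal_one]
  rw [hone, one_mul]

/-- The disintegration `μ_d(dℓ) = κ_{d-1}⁻¹ m_{d-1}(dy) m(dϖ)` of the invariant line measure: `ϖ` is
the direction of the line, and `y` its intersection with the hyperplane through the origin
orthogonal to `ϖ`. Here it is written as an integral over all unit vectors. -/
theorem lineMeasure_apply (d : ℕ) {B : Set (Line d)} (hB : MeasurableSet B) :
    lineMeasure d B = (2 * kappaPred d)⁻¹ *
      ∫⁻ u : Directions d, volume {y : (Submodule.span ℝ {(u : Space d)})ᗮ |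
        Line.through (y : Space d) u ∈ B} ∂(volume : Measure (Space d)).toSphere := by
  have hmeas := Line.measurable_through (d := d)
  have hpre := hmeas hB
  have hslab : MeasurableSet {p : Space d × Directions d |
      inner ℝ p.1 (p.2 : Space d) ∈ Icc (0 : ℝ) 1} := by
    have hc : Measurable (fun p : Space d × Directions d => inner ℝ p.1 (p.2 : Space d)) :=
      (continuous_fst.inner (continuous_subtype_val.comp continuous_snd)).measurable
    exact hc measurableSet_Icc
  rw [lineMeasure, Measure.smul_apply, smul_eq_mul, Measure.map_apply hmeas hB,
    Measure.restrict_apply hpre, Measure.prod_apply_symm (hpre.inter hslab)]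
  congr 1
  refine lintegral_congr fun u => ?_
  refine volume_inter_slab (u : Space d) (norm_eq_of_mem_sphere u)
    {x | Line.through x u ∈ B} fun w hw y => ?_
  rw [mem_ofPred_eq, mem_ofPred_eq, Line.through_add_smul y u hw]

/-! ### The marked Poisson line process -/

/-- `N` is (the random set of points of) a Poisson point process on `X` with σ-finite diffuse
intensity measure `ν`: the number of points in a set `B` of finite intensity is Poisson distributed
with mean `ν B`, and the numbers of points in disjoint sets are independent. -/
structure IsPoissonProcess {Ω X : Type*} [MeasurableSpace Ω] [MeasurableSpace X]
    (P : Measure Ω) (ν : Measure X) (N : Ω → Set X) : Prop where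
  measurable_count : ∀ B : Set X, MeasurableSet B → Measurable fun ω => (N ω ∩ B).encard
  count_eq : ∀ B : Set X, MeasurableSet B → ν B ≠ ∞ → ∀ n : ℕ,
    P {ω | (N ω ∩ B).encard = n} = poissonMeasure (ν B).toNNReal {n}
  indep : ∀ (k : ℕ) (B : Fin k → Set X), (∀ i, MeasurableSet (B i)) →
    Pairwise (fun i j => Disjoint (B i) (B j)) → iIndepFun (fun i ω => (N ω ∩ B i).encard) P

/-- The measure `(γ - 1) v^{-γ} dv` on the speeds `v > 0`. -/
noncomputable def speedMeasure (γ : ℝ) : Measure ℝ :=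
  (volume.restrict (Ioi (0 : ℝ))).withDensity fun v => ENNReal.ofReal ((γ - 1) * v ^ (-γ))

/-- The intensity measure `(γ - 1) v^{-γ} dv μ_d(dℓ)` of the marked line process. -/
noncomputable def lineIntensity (d : ℕ) (γ : ℝ) : Measure (Line d × ℝ) :=
  (lineMeasure d).prod (speedMeasure γ)

/-! ### Paths that obey the speed-limits -/

section Paths

variable {d : ℕ}

/-- The silhouette `𝒮_v` of a marked line pattern `L`: the union of its lines with speed-limit at
least `v`. -/
def silhouette (L : Set (Line d × ℝ)) (v : ℝ) : Set (Space d) :=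
  ⋃ p ∈ {p ∈ L | v ≤ p.2}, p.1.points

/-- `ξ` is a `Π`-path on the time interval `I`, for `Π` the marked line pattern `L`: it is locally
Lipschitz on `I` and, for each `v > 0`, at almost no time of `I` it moves faster than `v` off the
lines with speed-limit at least `v`. -/
def IsPiPath (L : Set (Line d × ℝ)) (I : Set ℝ) (ξ : ℝ → Space d) : Prop :=
  LocallyLipschitzOn I ξ ∧
    ∀ v : ℝ, 0 < v → volume {t ∈ I | v < ‖derivWithin ξ I t‖ ∧ ξ t ∉ silhouette L v} = 0

/-- `ξ` is a `Π`-path which connects `x` to `y` in the finite time `T`. Time `0` is allowed, to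
connect a point to itself. -/
def ConnectsIn (L : Set (Line d × ℝ)) (x y : Space d) (T : ℝ≥0) (ξ : ℝ → Space d) : Prop :=
  IsPiPath L (Icc 0 (T : ℝ)) ξ ∧ ξ 0 = x ∧ ξ T = y

/-- `ξ` is a `Π`-geodesic from `x` to `y` with duration `T`: it connects `x` to `y` in time `T`, and
no `Π`-path does so in less time. -/
def IsPiGeodesic (L : Set (Line d × ℝ)) (x y : Space d) (T : ℝ≥0) (ξ : ℝ → Space d) : Prop :=
  ConnectsIn L x y T ξ ∧ ∀ S < T, ¬ ∃ η : ℝ → Space d, ConnectsIn L x y S η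

/-- The minimal transit time from `x` to `y`: the infimum of the times in which a `Π`-path connects
`x` to `y` (`∞` if there is none). -/
noncomputable def transitTime (L : Set (Line d × ℝ)) (x y : Space d) : ℝ≥0∞ :=
  ⨅ (T : ℝ≥0) (_ : ∃ ξ : ℝ → Space d, ConnectsIn L x y T ξ), (T : ℝ≥0∞)

end Paths

/-! ### Geodesic metrics -/

/-- `τ` is a (finite) metric on `X`. -/
structure IsMetric {X : Type*} (τ : X → X → ℝ≥0∞) : Prop where
  ne_top : ∀ x y, τ x y ≠ ∞
  eq_zero_iff : ∀ x y, τ x y = 0 ↔ x = y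
  symm : ∀ x y, τ x y = τ y x
  triangle : ∀ x y z, τ x z ≤ τ x y + τ y z

/-- `c` restricts to an isometric embedding of `[0, T]` into `(X, τ)` which runs from `x` to `y`. -/
def IsMetricGeodesic {X : Type*} (τ : X → X → ℝ≥0∞) (x y : X) (T : ℝ≥0) (c : ℝ → X) : Prop :=
  c 0 = x ∧ c T = y ∧
    ∀ s ∈ Icc 0 (T : ℝ), ∀ t ∈ Icc 0 (T : ℝ), τ (c s) (c t) = ENNReal.ofReal |s - t|

/-- `τ` is a metric on `X` which makes it a geodesic metric space: every two points are joined by a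
geodesic. -/
def IsGeodesicMetric {X : Type*} (τ : X → X → ℝ≥0∞) : Prop :=
  IsMetric τ ∧ ∀ x y, ∃ (T : ℝ≥0) (c : ℝ → X), IsMetricGeodesic τ x y T c

/-!
The proof rests on a description of `Π`-paths without derivatives. A curve `f` is a `Π`-path if and
only if, for all `v > 0` and all times `s`, `t`, either `f s` and `f t` are at distance at most
`v |s - t|`, or the silhouette `𝒮_v` comes within distance `v |s - t|` of `f t`
(`IsPiPath.compliant`, `Compliant.isPiPath`). This needs only that the silhouettes are closed and
that speeds are locally bounded. The description is closed under pointwise limits, so that bounded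
sequences of approximate paths have limits along an ultrafilter which are paths
(`exists_compliant_of_approx`). All compactness arguments use this fact.

*Confinement.* As `γ > d`, the probability that a line of speed at least `ε R` hits the ball of
radius `R` tends to zero as `R → ∞`. Almost surely there are thus arbitrarily large `R` for which
there is no such line, so that paths of bounded duration stay in a fixed ball
(`IsPoissonProcess.ae_isTame`, `IsTame.exists_confining_ball`). Infima of connection times are
therefore attained (`transitTime_le_iff`). Positivity of the transit time and all claims about
geodesics follow, since paths can be restricted, reversed and concatenated (`IsTame.geodesic`).

*Connection.* Choose `α < σ / 2 < 1 / 2` with `α ^ (d - 1) > σ ^ (γ - 1)`, which is possible as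
`γ > d`. The number of lines of speed at least `σ ^ n` that pass within `α ^ (n + 1)` of two given
points at distance at most `α ^ n` has an expectation which grows geometrically in `n`. By the
Borel–Cantelli lemma over a fine grid of balls and directions, almost surely there is such a line
for all pairs of points at all small scales (`IsPoissonProcess.exists_ae_hasHierarchy`). Riding on
these lines and treating the remaining gaps recursively takes a bounded time. To avoid the
construction of an infinite concatenation, one permits the speed `σ ^ m` everywhere, stops the
recursion at scale `m`, and lets `m → ∞` in the bounds, which do not depend on `m`
(`HasHierarchy.connectedIn_withBackground`, `IsTame.connectedIn_of_tendsto`).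

*Measurability.* By compactness a connection in time `T` exists if and only if there are discrete
curves with values in a countable dense set which satisfy countably many conditions up to
arbitrarily small errors. Each condition says whether a silhouette meets a ball, that is, whether
the process has a point in a measurable set (`IsTame.connectedIn_iff`,
`IsPoissonProcess.aemeasurable_transitTime`).
-/

/-! ### Curves that comply with a family of speed limits -/

/-- A curve `f` on `[0, T]` complies with the family `S` of sets if, for each speed `v > 0`, it
moves at most at speed `v` as long as it is off `S v`. This is expressed without derivatives: if
`S v` keeps a distance larger than `v |s - t|` from `f t`, then `f s` and `f t` have distance at
most `v |s - t|`. The slack `δ` makes the condition stable under pointwise limits. -/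
def Compliant {E : Type*} [PseudoMetricSpace E] (S : ℝ → Set E) (T : ℝ) (f : ℝ → E) : Prop :=
  ∀ v, 0 < v → ∀ s ∈ Icc 0 T, ∀ t ∈ Icc 0 T, ∀ δ, 0 < δ →
    dist (f s) (f t) < v * |s - t| + δ ∨ ∃ p ∈ S v, dist (f t) p < v * |s - t| + δ

/-- The points `x` and `y` are connected in time `T` by a curve which complies with `S`. -/
def ConnectedIn {E : Type*} [PseudoMetricSpace E] (S : ℝ → Set E) (T : ℝ) (x y : E) : Prop :=
  ∃ f : ℝ → E, Compliant S T f ∧ f 0 = x ∧ f T = y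

section Compliant

variable {E : Type*} [PseudoMetricSpace E] {S : ℝ → Set E} {T : ℝ} {f : ℝ → E}

/-- A curve stays below speed `v` while `S v` is out of its reach. -/
theorem Compliant.dist_le (hf : Compliant S T f) {v s t r : ℝ} (hv : 0 < v) (hs : s ∈ Icc 0 T)
    (ht : t ∈ Icc 0 T) (hr : v * |s - t| < r) (hS : ∀ p ∈ S v, r ≤ dist (f t) p) :
    dist (f s) (f t) ≤ v * |s - t| := by
  refine le_of_forall_pos_lt_add fun δ hδ => ?_
  have hm : 0 < min δ (r - v * |s - t|) := lt_min hδ (by linarith)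
  rcases hf v hv s hs t ht _ hm with h | ⟨p, hp, h⟩
  · exact h.trans_le (by gcongr; exact min_le_left _ _)
  · have := hS p hp
    have := min_le_right δ (r - v * |s - t|)
    linarith

theorem compliant_of_dist_le
    (h : ∀ v, 0 < v → ∀ s ∈ Icc 0 T, ∀ t ∈ Icc 0 T, ∀ r, v * |s - t| < r →
      (∀ p ∈ S v, r ≤ dist (f t) p) → dist (f s) (f t) ≤ v * |s - t|) : Compliant S T f := by
  intro v hv s hs t ht δ hδ
  by_contra! hcon
  have := h v hv s hs t ht (v * |s - t| + δ) (by linarith) hcon.2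
  linarith [hcon.1]

theorem Compliant.comp (hf : Compliant S T f) {U : ℝ} {θ : ℝ → ℝ}
    (hθ : ∀ t ∈ Icc 0 U, θ t ∈ Icc 0 T)
    (hd : ∀ s ∈ Icc 0 U, ∀ t ∈ Icc 0 U, |θ s - θ t| ≤ |s - t|) : Compliant S U (f ∘ θ) := by
  intro v hv s hs t ht δ hδ
  have hle : v * |θ s - θ t| + δ ≤ v * |s - t| + δ :=
    add_le_add_left (mul_le_mul_of_nonneg_left (hd s hs t ht) hv.le) δ
  rcases hf v hv _ (hθ s hs) _ (hθ t ht) δ hδ with h | ⟨p, hp, h⟩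
  · exact .inl (h.trans_le hle)
  · exact .inr ⟨p, hp, h.trans_le hle⟩

theorem ConnectedIn.refl (x : E) : ConnectedIn S 0 x x := by
  refine ⟨fun _ => x, fun v hv s hs t ht δ hδ => .inl ?_, rfl, rfl⟩
  rw [dist_self]
  positivity

theorem ConnectedIn.symm {x y : E} (h : ConnectedIn S T x y) : ConnectedIn S T y x := by
  obtain ⟨f, hf, h0, hT⟩ := h
  refine ⟨f ∘ (fun t => T - t), hf.comp (fun t ht => ⟨by linarith [ht.2], by linarith [ht.1]⟩)
    fun s _ t _ => ?_, by simpa, by simpa⟩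
  rw [show T - s - (T - t) = -(s - t) by ring, abs_neg]

theorem ConnectedIn.mono {x y : E} {U : ℝ} (h : ConnectedIn S T x y) (hT : 0 ≤ T) (hU : T ≤ U) :
    ConnectedIn S U x y := by
  obtain ⟨f, hf, h0, hfT⟩ := h
  refine ⟨f ∘ (fun t => min t T), hf.comp (fun t ht => ⟨le_min ht.1 hT, min_le_right _ _⟩)
    fun s _ t _ => ?_, by simpa [hT], by simpa [hU]⟩
  simpa using abs_min_sub_min_le_max s T t T

/-- While going from one piece of a concatenation to the other, a curve is governed by the
condition at the junction: the distance to `S v` is a Lipschitz function. -/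
theorem Compliant.dist_le_of_junction {S : ℝ → Set E} {f g : ℝ → E} {U V : ℝ}
    (hf : Compliant S U f) (hg : Compliant S V g) {a b c e v r : ℝ} (hv : 0 < v)
    (ha : a ∈ Icc 0 U) (hb : b ∈ Icc 0 U) (hc : c ∈ Icc 0 V) (he : e ∈ Icc 0 V)
    (hj : f b = g c) (hr : v * (|a - b| + |c - e|) < r) (hS : ∀ p ∈ S v, r ≤ dist (g e) p) :
    dist (f a) (g e) ≤ v * (|a - b| + |c - e|) := by
  have h0 := mul_nonneg hv.le (abs_nonneg (a - b))
  have h1 : dist (g c) (g e) ≤ v * |c - e| :=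
    hg.dist_le hv hc he (lt_of_le_of_lt (by linarith) hr) hS
  have h2 : dist (f a) (f b) ≤ v * |a - b| := by
    refine hf.dist_le (r := r - v * |c - e|) hv ha hb (by linarith) fun p hp => ?_
    have := hS p hp
    have := dist_triangle (g e) (g c) p
    rw [hj]
    rw [dist_comm (g e) (g c)] at this
    linarith
  calc dist (f a) (g e) ≤ dist (f a) (f b) + dist (g c) (g e) := by
        rw [← hj]; exact dist_triangle _ _ _
    _ ≤ _ := by linarith

theorem ConnectedIn.trans {x y z : E} {U V : ℝ} (h : ConnectedIn S U x y)
    (h' : ConnectedIn S V y z) (hU : 0 ≤ U) (hV : 0 ≤ V) : ConnectedIn S (U + V) x z := by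
  obtain ⟨f, hf, hf0, hfU⟩ := h
  obtain ⟨g, hg, hg0, hgV⟩ := h'
  have hj : f U = g 0 := hfU.trans hg0.symm
  have hlate : ∀ t, U ≤ t → (if t ≤ U then f t else g (t - U)) = g (t - U) := fun t ht => by
    rcases ht.eq_or_lt with rfl | ht
    · simp [hj]
    · simp [ht]
  refine ⟨fun t => if t ≤ U then f t else g (t - U), compliant_of_dist_le ?_, by simp [hU, hf0], ?_⟩
  · intro v hv s hs t ht r hr hS
    rcases le_total s U with hsU | hsU <;> rcases le_total t U with htU | htU
    · simp only [hsU, htU, if_true] at hS ⊢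
      exact hf.dist_le hv ⟨hs.1, hsU⟩ ⟨ht.1, htU⟩ hr hS
    · simp only [hlate t htU, hsU, if_true] at hS ⊢
      have habs : |s - U| + |0 - (t - U)| = |s - t| := by
        rw [abs_of_nonpos (by linarith), abs_of_nonpos (by linarith), abs_of_nonpos (by linarith)]
        ring
      rw [← habs] at hr ⊢
      exact hf.dist_le_of_junction hg hv ⟨hs.1, hsU⟩ ⟨hU, le_rfl⟩ ⟨le_rfl, hV⟩
        ⟨by linarith, by linarith [ht.2]⟩ hj hr hS
    · simp only [hlate s hsU, htU, if_true] at hS ⊢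
      have habs : |s - U - 0| + |U - t| = |s - t| := by
        rw [abs_of_nonneg (by linarith), abs_of_nonneg (by linarith), abs_of_nonneg (by linarith)]
        ring
      rw [← habs] at hr ⊢
      exact hg.dist_le_of_junction hf hv ⟨by linarith, by linarith [hs.2]⟩ ⟨le_rfl, hV⟩
        ⟨hU, le_rfl⟩ ⟨ht.1, htU⟩ hj.symm hr hS
    · simp only [hlate s hsU, hlate t htU] at hS ⊢
      have habs : |s - U - (t - U)| = |s - t| := by congr 1; ring
      rw [← habs] at hr ⊢
      exact hg.dist_le hv ⟨by linarith, by linarith [hs.2]⟩ ⟨by linarith, by linarith [ht.2]⟩ hr hS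
  · simp only [hlate (U + V) (by linarith)]
    simpa using hgV

theorem Compliant.connectedIn (hf : Compliant S T f) {a b : ℝ} (ha : a ∈ Icc 0 T)
    (hb : b ∈ Icc 0 T) : ConnectedIn S (b - a) (f a) (f b) := by
  refine ⟨f ∘ (fun t => a + t), hf.comp (fun t ht => ⟨by linarith [ht.1, ha.1],
    by linarith [ht.2, hb.2]⟩) fun s _ t _ => ?_, by simp, by simp⟩
  rw [show a + s - (a + t) = s - t by ring]

/-- Compliance passes to pointwise limits along an ultrafilter. As the curves are bounded, such
limits exist, and no equicontinuity is needed. -/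
theorem exists_compliant_of_approx [ProperSpace E] (o : E) (R : ℝ) (F : ℕ → ℝ → E)
    (hR : ∀ n, ∀ t ∈ Icc 0 T, F n t ∈ Metric.closedBall o R)
    (hF : ∀ v, 0 < v → ∀ s ∈ Icc 0 T, ∀ t ∈ Icc 0 T, ∀ δ, 0 < δ → ∀ᶠ n in Filter.atTop,
      dist (F n s) (F n t) < v * |s - t| + δ ∨ ∃ p ∈ S v, dist (F n t) p < v * |s - t| + δ) :
    ∃ f : ℝ → E, Compliant S T f ∧
      ∀ t ∈ Icc 0 T, Filter.Tendsto (F · t) (Filter.hyperfilter ℕ) (nhds (f t)) := by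
  have hlim : ∀ t, ∃ z : E, t ∈ Icc 0 T →
      Filter.Tendsto (F · t) (Filter.hyperfilter ℕ) (nhds z) := by
    intro t
    by_cases ht : t ∈ Icc 0 T
    · obtain ⟨z, -, hz⟩ := (isCompact_closedBall o R).ultrafilter_le_nhds
        ((Filter.hyperfilter ℕ).map (F · t))
        (by
          rw [Filter.le_principal_iff]
          exact Filter.mem_map.2 (Filter.univ_mem' fun n => hR n t ht))
      exact ⟨z, fun _ => hz⟩
    · exact ⟨o, fun h => absurd h ht⟩
  choose f hf using hlim
  refine ⟨f, ?_, hf⟩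
  intro v hv s hs t ht δ hδ
  have hev := Nat.hyperfilter_le_atTop (hF v hv s hs t ht (δ / 2) (by linarith))
  have h1 := (hf s hs).dist (hf t ht)
  have h2 : ∀ᶠ n in (Filter.hyperfilter ℕ : Filter ℕ), dist (f t) (F n t) < δ / 2 := by
    have := (hf t ht).eventually (Metric.ball_mem_nhds (f t) (half_pos hδ))
    filter_upwards [this] with n hn
    rw [dist_comm]
    exact hn
  rcases Ultrafilter.eventually_or.1 hev with h | h
  · left
    have hle : dist (f s) (f t) ≤ v * |s - t| + δ / 2 := le_of_tendsto h1 (h.mono fun n hn => hn.le)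
    linarith
  · right
    obtain ⟨n, ⟨p, hp, hn⟩, hn'⟩ := (h.and h2).exists
    refine ⟨p, hp, ?_⟩
    have := dist_triangle (f t) (F n t) p
    linarith

/-- If at some large radius `R` the set `S v` misses the ball of radius `R`, a curve with duration
`T` that starts well inside the ball does not leave it. -/
theorem Compliant.dist_zero_le (hf : Compliant S T f) {v R : ℝ} {o : E} (hv : 0 < v)
    (hS : Disjoint (S v) (Metric.ball o R)) (h0 : dist (f 0) o + v * T < R) {t : ℝ}
    (ht : t ∈ Icc 0 T) : dist (f t) o ≤ dist (f 0) o + v * T := by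
  have habs : |t - 0| ≤ T := by rw [sub_zero, abs_of_nonneg ht.1]; exact ht.2
  have hvT : v * |t - 0| ≤ v * T := by gcongr
  have h := hf.dist_le (r := R - dist (f 0) o) hv ht ⟨le_rfl, ht.1.trans ht.2⟩ (by linarith)
    fun p hp => by
      have h1 : R ≤ dist p o := by
        by_contra! hlt
        exact Set.disjoint_left.1 hS hp hlt
      have := dist_triangle p (f 0) o
      rw [dist_comm p (f 0)] at this
      linarith
  have := dist_triangle (f t) (f 0) o
  linarith

end Compliant

/-! ### Paths that obey the speed-limits as compliant curves -/

/-- A Lipschitz curve whose speed is almost everywhere at most `v` is `v`-Lipschitz. -/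
theorem LipschitzOnWith.dist_le_of_ae_norm_deriv_le {E : Type*} [NormedAddCommGroup E]
    [InnerProductSpace ℝ E] [FiniteDimensional ℝ E] {K : ℝ≥0} {f : ℝ → E} {a b v : ℝ}
    (hf : LipschitzOnWith K f (uIcc a b)) (h : ∀ᵐ t, t ∈ uIoo a b → ‖deriv f t‖ ≤ v) :
    dist (f a) (f b) ≤ v * |b - a| := by
  set w := f b - f a with hw
  rw [dist_comm, dist_eq_norm, ← hw]
  rcases eq_or_ne w 0 with h0 | h0
  · rcases eq_or_ne a b with rfl | hab
    · simp [h0]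
    · have hpos : volume (uIoo a b) ≠ 0 := by
        simp only [uIoo, Real.volume_Ioo, ne_eq, ENNReal.ofReal_eq_zero, not_le, sub_pos, inf_lt_sup]
        exact hab
      have hv : 0 ≤ v := by
        by_contra! hv
        refine hpos (measure_mono_null (fun t ht => ?_) (ae_iff.1 h))
        simp only [mem_ofPred_eq, Classical.not_imp, not_le]
        exact ⟨ht, hv.trans_le (norm_nonneg _)⟩
      rw [h0, norm_zero]
      positivity
  have hg := ((innerSL ℝ w).lipschitz.comp_lipschitzOnWith hf).absolutelyContinuousOnInterval
  have hint := hg.integral_deriv_eq_sub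
  have hbound : ‖∫ t in a..b, deriv (innerSL ℝ w ∘ f) t‖ ≤ ‖w‖ * v * |b - a| := by
    refine intervalIntegral.norm_integral_le_of_norm_le_const_ae ?_
    have hb : ∀ᵐ t : ℝ, t ≠ max a b := by simp [ae_iff, measure_singleton]
    filter_upwards [h, hf.ae_differentiableWithinAt_of_mem_real, hb] with t ht hd htb htI
    have htoo : t ∈ uIoo a b := ⟨htI.1, lt_of_le_of_ne htI.2 htb⟩
    have hnhds : uIcc a b ∈ nhds t := Icc_mem_nhds htoo.1 htoo.2
    have hda : DifferentiableAt ℝ f t := (hd (uIoc_subset_uIcc htI)).differentiableAt hnhds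
    have hder : deriv (innerSL ℝ w ∘ f) t = inner ℝ w (deriv f t) :=
      (((innerSL ℝ w).hasFDerivAt.comp_hasDerivAt t hda.hasDerivAt)).deriv
    rw [hder]
    exact (norm_inner_le_norm _ _).trans
      (mul_le_mul_of_nonneg_left (ht htoo) (norm_nonneg _))
  rw [hint] at hbound
  have hsq : (innerSL ℝ w ∘ f) b - (innerSL ℝ w ∘ f) a = ‖w‖ * ‖w‖ := by
    simp only [Function.comp, innerSL_apply_apply, ← inner_sub_right, ← hw]
    exact real_inner_self_eq_norm_mul_norm w
  rw [hsq, Real.norm_of_nonneg (by positivity), mul_assoc] at hbound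
  exact le_of_mul_le_mul_left hbound (norm_pos_iff.2 h0)

section

variable {d : ℕ} {L : Set (Line d × ℝ)} {T : ℝ} {ξ : ℝ → Space d}

theorem silhouette_antitone (L : Set (Line d × ℝ)) : Antitone (silhouette L) := by
  intro v w hvw x hx
  simp only [silhouette, mem_iUnion, mem_ofPred_eq] at hx ⊢
  obtain ⟨p, ⟨hp, hw⟩, hx⟩ := hx
  exact ⟨p, ⟨hp, hvw.trans hw⟩, hx⟩

/-- Within its distance to `silhouette L v` a `Π`-path is `v`-Lipschitz: up to its first exit from
the ball around `ξ t` that the silhouette misses, its speed is at most `v`, hence that exit comes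
too late. -/
theorem IsPiPath.compliant (h : IsPiPath L (Icc 0 T) ξ) : Compliant (silhouette L) T ξ := by
  obtain ⟨K, hK⟩ := h.1.exists_lipschitzOnWith_of_compact isCompact_Icc
  refine compliant_of_dist_le fun v hv s hs t ht r hr hS => ?_
  -- Running from `t` to `s` along `θ` treats `s ≤ t` and `t ≤ s` alike.
  set θ : ℝ → ℝ := fun l => t + l * (s - t) with hθ
  have hmem : ∀ l ∈ Icc (0 : ℝ) 1, θ l ∈ Icc 0 T := fun l hl => by
    have h1 : θ l = (1 - l) * t + l * s := by simp only [hθ]; ring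
    have h2 := hl.1
    have h3 : 0 ≤ 1 - l := by linarith [hl.2]
    rw [h1]
    constructor
    · have := mul_nonneg h3 ht.1
      have := mul_nonneg h2 hs.1
      linarith
    · have := mul_le_mul_of_nonneg_left ht.2 h3
      have := mul_le_mul_of_nonneg_left hs.2 h2
      linarith
  have hstep : ∀ l ∈ Icc (0 : ℝ) 1, (∀ k, 0 ≤ k → k < l → dist (ξ t) (ξ (θ k)) < r) →
      dist (ξ t) (ξ (θ l)) ≤ v * |s - t| := by
    intro l hl hk
    have hsub : uIcc t (θ l) ⊆ Icc 0 T := by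
      rw [uIcc_eq_union]
      exact union_subset (Icc_subset_Icc ht.1 (hmem l hl).2) (Icc_subset_Icc (hmem l hl).1 ht.2)
    have hae : ∀ᵐ u, u ∈ uIoo t (θ l) → ‖deriv ξ u‖ ≤ v := by
      filter_upwards [compl_mem_ae_iff.2 (h.2 v hv)] with u hu huI
      have huI' : u ∈ Ioo 0 T :=
        ⟨lt_of_le_of_lt (le_min ht.1 (hmem l hl).1) huI.1,
          lt_of_lt_of_le huI.2 (max_le ht.2 (hmem l hl).2)⟩
      have hnear : dist (ξ t) (ξ u) < r := by
        have hst : s - t ≠ 0 := by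
          intro h0
          simp only [hθ, h0, mul_zero, add_zero, uIoo_self] at huI
          exact huI
        have hu' : u = θ ((u - t) / (s - t)) := by simp only [hθ]; field_simp; ring
        rw [hu']
        simp only [uIoo, hθ, mem_Ioo, inf_lt_iff, lt_sup_iff] at huI
        rcases lt_or_gt_of_ne hst with hst' | hst'
        · have hlst := mul_nonpos_of_nonneg_of_nonpos hl.1 hst'.le
          refine hk _ (div_nonneg_of_nonpos ?_ hst'.le) ?_
          · rcases huI.2 with h | h <;> linarith
          · rw [div_lt_iff_of_neg hst']
            rcases huI.1 with h | h <;> linarith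
        · have hlst := mul_nonneg hl.1 hst'.le
          refine hk _ (div_nonneg ?_ hst'.le) ?_
          · rcases huI.1 with h | h <;> linarith
          · rw [div_lt_iff₀ hst']
            rcases huI.2 with h | h <;> linarith
      have hoff : ξ u ∉ silhouette L v := fun hp => (hS _ hp).not_gt hnear
      by_contra! hgt
      refine hu ⟨Ioo_subset_Icc_self huI', ?_, hoff⟩
      rwa [derivWithin_of_mem_nhds (Icc_mem_nhds huI'.1 huI'.2)]
    refine ((hK.mono hsub).dist_le_of_ae_norm_deriv_le hae).trans ?_
    have : |θ l - t| = l * |s - t| := by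
      simp only [hθ, add_sub_cancel_left, abs_mul, abs_of_nonneg hl.1]
    rw [this]
    gcongr
    exact mul_le_of_le_one_left (abs_nonneg _) hl.2
  have hcont : ContinuousOn (fun l => dist (ξ t) (ξ (θ l))) (Icc 0 1) :=
    (continuous_const.dist continuous_id).comp_continuousOn
      (h.1.continuousOn.comp (by fun_prop) hmem)
  have hall : ∀ l ∈ Icc (0 : ℝ) 1, dist (ξ t) (ξ (θ l)) < r := by
    by_contra! hex
    have hcl : IsCompact (Icc (0 : ℝ) 1 ∩ (fun l => dist (ξ t) (ξ (θ l))) ⁻¹' Ici r) :=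
      isCompact_Icc.of_isClosed_subset
        (hcont.preimage_isClosed_of_isClosed isClosed_Icc isClosed_Ici) inter_subset_left
    obtain ⟨l, hl⟩ := hcl.exists_isLeast (by obtain ⟨l, h1, h2⟩ := hex; exact ⟨l, h1, h2⟩)
    refine (hl.1.2 : r ≤ _).not_gt ((hstep l hl.1.1 fun k hk0 hkl => ?_).trans_lt hr)
    by_contra! hge
    exact hkl.not_ge (hl.2 ⟨⟨hk0, hkl.le.trans hl.1.1.2⟩, hge⟩)
  have hfin := hstep 1 (by simp) fun k hk0 hk1 => hall k ⟨hk0, hk1.le⟩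
  rw [dist_comm]
  simpa [hθ] using hfin

/-- Conversely a compliant curve is a `Π`-path, if the silhouettes are closed and speeds are
locally bounded. -/
theorem Compliant.isPiPath (h : Compliant (silhouette L) T ξ)
    (hclosed : ∀ v, 0 < v → IsClosed (silhouette L v))
    (hbdd : ∀ R, ∃ v, 0 < v ∧ Disjoint (silhouette L v) (Metric.ball 0 R)) :
    IsPiPath L (Icc 0 T) ξ := by
  constructor
  · intro t₀ ht₀
    obtain ⟨v, hv, hdisj⟩ := hbdd (‖ξ t₀‖ + 2)
    have hfar : ∀ p ∈ silhouette L v, 2 ≤ dist (ξ t₀) p := fun p hp => by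
      by_contra! hlt
      refine Set.disjoint_left.1 hdisj hp ?_
      have := dist_triangle p (ξ t₀) 0
      rw [dist_zero_right, dist_zero_right, dist_comm p] at this
      rw [mem_ball_zero_iff]
      linarith
    refine ⟨v.toNNReal, Icc 0 T ∩ Metric.ball t₀ (1 / (2 * v)),
      inter_mem_nhdsWithin _ (Metric.ball_mem_nhds _ (by positivity)), ?_⟩
    have hnear : ∀ t ∈ Icc 0 T ∩ Metric.ball t₀ (1 / (2 * v)), v * |t - t₀| < 1 / 2 := by
      rintro t ⟨-, ht⟩
      rw [Metric.mem_ball, Real.dist_eq, lt_div_iff₀ (by positivity)] at ht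
      linarith
    refine LipschitzOnWith.of_dist_le_mul fun s hs t ht => ?_
    rw [Real.coe_toNNReal _ hv.le, Real.dist_eq]
    have h1 := hnear s hs
    have h2 := hnear t ht
    have h3 := h.dist_le hv ht.1 ht₀ (h2.trans (by norm_num)) hfar
    have h4 : v * |s - t| ≤ v * |s - t₀| + v * |t - t₀| := by
      rw [← mul_add, abs_sub_comm t t₀]
      exact mul_le_mul_of_nonneg_left (abs_sub_le _ _ _) hv.le
    refine h.dist_le (r := 1) hv hs.1 ht.1 (by linarith) fun p hp => ?_
    have := hfar p hp
    have := dist_triangle_left (ξ t₀) p (ξ t)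
    linarith
  · intro v hv
    convert! measure_empty (μ := volume)
    rw [eq_empty_iff_forall_notMem]
    rintro t ⟨ht, hlt, hoff⟩
    refine hlt.not_ge ?_
    obtain ⟨r, hr, hball⟩ := Metric.isOpen_iff.1 (hclosed v hv).isOpen_compl _ hoff
    by_cases hd : DifferentiableWithinAt ℝ ξ (Icc 0 T) t
    swap
    · rw [derivWithin_zero_of_not_differentiableWithinAt hd, norm_zero]
      exact hv.le
    rcases (nhdsWithin t (Icc 0 T \ {t})).eq_or_neBot with hbot | hne
    · rw [derivWithin_zero_of_not_accPt, norm_zero]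
      · exact hv.le
      · rw [accPt_principal_iff_nhdsWithin, hbot]
        exact fun hne => hne.ne rfl
    have htend := (hasDerivWithinAt_iff_tendsto_slope.1 hd.hasDerivWithinAt).norm
    refine le_of_tendsto htend ?_
    have hmem : Metric.ball t (r / v) ∈ nhdsWithin t (Icc 0 T \ {t}) :=
      mem_nhdsWithin_of_mem_nhds (Metric.ball_mem_nhds _ (by positivity))
    filter_upwards [hmem, self_mem_nhdsWithin] with s hs hsI
    rw [Metric.mem_ball, Real.dist_eq, lt_div_iff₀ hv, mul_comm] at hs
    have hst : s - t ≠ 0 := sub_ne_zero.2 hsI.2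
    have := h.dist_le hv hsI.1 ht hs fun p hp => by
      by_contra! hlt'
      exact hball (Metric.mem_ball'.2 hlt') hp
    rw [slope_def_module, norm_smul, norm_inv, Real.norm_eq_abs, ← dist_eq_norm,
      inv_mul_le_iff₀ (abs_pos.2 hst), mul_comm]
    exact this

end

/-! ### Tame patterns: limits of curves and geodesics -/

/-- The family `S` after everyone is given permission to move at speed `e` everywhere. -/
def withBackground {E : Type*} (e : ℝ) (S : ℝ → Set E) (v : ℝ) : Set E := {p | v ≤ e ∨ p ∈ S v}

/-- The properties of an antitone family of sets, such as the silhouettes of a pattern, that make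
the compliant curves a compact family: closedness, and a sublinear growth of the maximal speed in
the ball of radius `R` (along a sequence of radii), which prevents curves from escaping to infinity
in finite time. -/
structure IsTame {d : ℕ} (S : ℝ → Set (Space d)) : Prop where
  antitone : Antitone S
  isClosed : ∀ v, 0 < v → IsClosed (S v)
  sparse : ∀ ε, 0 < ε → ∀ R₀, ∃ R > R₀, Disjoint (S (ε * R)) (Metric.ball 0 R)

section Tame

variable {d : ℕ} {S : ℝ → Set (Space d)}

theorem Compliant.mono {E : Type*} [PseudoMetricSpace E] {S S' : ℝ → Set E} {T : ℝ} {f : ℝ → E}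
    (hf : Compliant S T f) (h : ∀ v, 0 < v → S v ⊆ S' v) : Compliant S' T f :=
  fun v hv s hs t ht δ hδ =>
    (hf v hv s hs t ht δ hδ).imp_right fun ⟨p, hp, hlt⟩ => ⟨p, h v hv hp, hlt⟩

theorem ConnectedIn.withBackground {E : Type*} [PseudoMetricSpace E] {S : ℝ → Set E} {T : ℝ}
    {x y : E} (h : ConnectedIn S T x y) (e : ℝ) : ConnectedIn (withBackground e S) T x y := by
  obtain ⟨f, hf, h0, hT⟩ := h
  exact ⟨f, hf.mono fun v _ p hp => .inr hp, h0, hT⟩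

theorem IsTame.exists_disjoint_ball (hS : IsTame S) (R : ℝ) :
    ∃ v, 1 < v ∧ Disjoint (S v) (Metric.ball 0 R) := by
  obtain ⟨R', hR', h⟩ := hS.sparse 1 one_pos (max R 1)
  rw [one_mul] at h
  exact ⟨R', (le_max_right _ _).trans_lt hR',
    h.mono_right (Metric.ball_subset_ball ((le_max_left _ _).trans hR'.le))⟩

/-- Compliant curves of bounded duration from a given point stay in a common ball, uniformly in
the background speed. -/
theorem IsTame.exists_confining_ball (hS : IsTame S) (x : Space d) (T : ℝ) :
    ∃ R, ∀ e ≤ 1, ∀ U ≤ T, ∀ f : ℝ → Space d, Compliant (withBackground e S) U f → f 0 = x →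
      ∀ t ∈ Icc 0 U, f t ∈ Metric.closedBall 0 R := by
  -- At speed `ε R` with this `ε` one covers less than `R / 2` in time `T`; moreover `ε R` exceeds
  -- the background speed.
  have hε : 0 < 1 / (2 * (|T| + 1)) := by positivity
  obtain ⟨R, hR, hdisj⟩ := hS.sparse _ hε (max (2 * ‖x‖) (1 / (1 / (2 * (|T| + 1)))))
  set ε := 1 / (2 * (|T| + 1)) with hεdef
  obtain ⟨hR1, hR2⟩ := max_lt_iff.1 hR
  have hR0 : 0 < R := lt_of_le_of_lt (by positivity) hR1
  have hv1 : 1 < ε * R := by rwa [div_lt_iff₀ hε, mul_comm] at hR2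
  refine ⟨R, fun e he U hU f hf hfx t ht => ?_⟩
  have hslow : ε * R * U < R / 2 := by
    have h1 : ε * R * U ≤ ε * R * |T| :=
      mul_le_mul_of_nonneg_left (hU.trans (le_abs_self T)) (by positivity)
    have h2 : ε * R * |T| = R / 2 - ε * R := by rw [hεdef]; field_simp; ring
    linarith
  have hx : dist (f 0) 0 = ‖x‖ := by rw [hfx, dist_zero_right]
  have hdisj' : Disjoint (withBackground e S (ε * R)) (Metric.ball 0 R) := by
    refine hdisj.mono_left fun p hp => ?_
    rcases hp with hp | hp
    · linarith
    · exact hp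
  have := hf.dist_zero_le (o := 0) (by linarith) hdisj' (by rw [hx]; linarith) ht
  rw [hx] at this
  rw [Metric.mem_closedBall]
  linarith

/-- Connections in times `T n → T`, with background speeds `e n → 0`, yield a connection in time
`T` without background speed. -/
theorem IsTame.connectedIn_of_tendsto (hS : IsTame S) {x y : Space d} {T : ℝ} {U e : ℕ → ℝ}
    (hU : Filter.Tendsto U Filter.atTop (nhds T)) (hU0 : ∀ n, 0 ≤ U n)
    (he : Filter.Tendsto e Filter.atTop (nhds 0)) (he1 : ∀ n, e n ≤ 1)
    (h : ∀ n, ConnectedIn (withBackground (e n) S) (U n) x y) : ConnectedIn S T x y := by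
  have hT0 : 0 ≤ T := ge_of_tendsto' hU hU0
  choose f hf hf0 hfU using h
  have hdisj : ∀ {n v} {p : Space d}, e n < v → p ∈ withBackground (e n) S v → p ∈ S v := by
    rintro n v p hlt (hp | hp)
    · linarith
    · exact hp
  -- For `T = 0` time cannot be rescaled; but then `x = y`, as speeds are locally bounded.
  rcases hT0.eq_or_lt with rfl | hT
  · obtain ⟨v, hv, hdis⟩ := hS.exists_disjoint_ball (‖x‖ + 1)
    have hle : dist x y ≤ v * 0 := by
      refine ge_of_tendsto (hU.const_mul v) ?_
      have hsmall : ∀ᶠ n in Filter.atTop, v * U n < 1 :=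
        (hU.const_mul v).eventually_lt_const (by simp)
      filter_upwards [hsmall] with n hn
      have habs : |U n - 0| = U n := by rw [sub_zero, abs_of_nonneg (hU0 n)]
      have := (hf n).dist_le (v := v) (s := U n) (t := 0) (r := 1) (by linarith)
        ⟨hU0 n, le_rfl⟩ ⟨le_rfl, hU0 n⟩ (by rwa [habs]) fun p hp => by
          by_contra! hlt
          refine Set.disjoint_left.1 hdis (hdisj ((he1 n).trans_lt hv) hp) ?_
          rw [hf0] at hlt
          have := norm_le_norm_add_norm_sub x p
          rw [← dist_eq_norm] at this
          rw [mem_ball_zero_iff]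
          linarith
      rwa [habs, hf0, hfU, dist_comm] at this
    rw [mul_zero] at hle
    obtain rfl := dist_le_zero.1 hle
    exact ConnectedIn.refl x
  obtain ⟨B, hB⟩ := hU.bddAbove_range
  obtain ⟨R, hR⟩ := hS.exists_confining_ball x B
  have hscale : ∀ n, ∀ t ∈ Icc 0 T, t * (U n / T) ∈ Icc 0 (U n) := by
    intro n t ht
    have := hU0 n
    refine ⟨by have := ht.1; positivity, ?_⟩
    rw [← mul_div_assoc, div_le_iff₀ hT, mul_comm]
    exact mul_le_mul_of_nonneg_left ht.2 this
  obtain ⟨g, hg, hlim⟩ := exists_compliant_of_approx (S := S) (T := T) 0 R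
    (fun n t => f n (t * (U n / T)))
    (fun n t ht => hR (e n) (he1 n) (U n) (hB ⟨n, rfl⟩) _ (hf n) (hf0 n) _ (hscale n t ht))
    (fun v hv s hs t ht δ hδ => by
      have hconv : Filter.Tendsto (fun n => v * (|s - t| * (U n / T))) Filter.atTop
          (nhds (v * |s - t|)) := by
        have := ((hU.div_const T).const_mul |s - t|).const_mul v
        rwa [div_self hT.ne', mul_one] at this
      filter_upwards [hconv.eventually_lt_const (show v * |s - t| < v * |s - t| + δ / 2 by linarith),
        he.eventually_lt_const hv] with n hn hen
      have habs : |s * (U n / T) - t * (U n / T)| = |s - t| * (U n / T) := by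
        rw [← sub_mul, abs_mul, abs_of_nonneg (div_nonneg (hU0 n) hT0)]
      rcases hf n v hv _ (hscale n s hs) _ (hscale n t ht) (δ / 2) (by linarith) with h | ⟨p, hp, h⟩
      · rw [habs] at h
        exact .inl (by linarith)
      · rw [habs] at h
        exact .inr ⟨p, hdisj hen hp, by linarith⟩)
  refine ⟨g, hg, ?_, ?_⟩
  · refine tendsto_nhds_unique (hlim 0 ⟨le_rfl, hT0⟩) ?_
    simp only [zero_mul, hf0]
    exact tendsto_const_nhds
  · refine tendsto_nhds_unique (hlim T ⟨hT0, le_rfl⟩) ?_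
    simp only [mul_div_cancel₀ _ hT.ne', hfU]
    exact tendsto_const_nhds

variable {L : Set (Line d × ℝ)}

theorem connectsIn_iff (hL : IsTame (silhouette L)) {x y : Space d} {T : ℝ≥0} {ξ : ℝ → Space d} :
    ConnectsIn L x y T ξ ↔ Compliant (silhouette L) T ξ ∧ ξ 0 = x ∧ ξ T = y := by
  refine and_congr_left fun _ => ⟨IsPiPath.compliant, fun h => h.isPiPath hL.isClosed fun R => ?_⟩
  obtain ⟨v, hv, h⟩ := hL.exists_disjoint_ball R
  exact ⟨v, by linarith, h⟩

theorem exists_connectsIn_iff (hL : IsTame (silhouette L)) {x y : Space d} {T : ℝ≥0} :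
    (∃ ξ, ConnectsIn L x y T ξ) ↔ ConnectedIn (silhouette L) T x y := by
  simp only [connectsIn_iff hL, ConnectedIn]

/-- The infimum that defines the transit time is attained. -/
theorem transitTime_le_iff (hL : IsTame (silhouette L)) {x y : Space d} {T : ℝ≥0} :
    transitTime L x y ≤ T ↔ ConnectedIn (silhouette L) T x y := by
  constructor
  · intro h
    have hex : ∀ n : ℕ, ConnectedIn (withBackground 0 (silhouette L)) (T + 1 / ((n : ℝ) + 1)) x y := by
      intro n
      have hlt : transitTime L x y < ((T + 1 / ((n : ℝ≥0) + 1) : ℝ≥0) : ℝ≥0∞) :=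
        h.trans_lt (ENNReal.coe_lt_coe.2 (lt_add_of_pos_right _ (by positivity)))
      simp only [transitTime, iInf_lt_iff] at hlt
      obtain ⟨U, hU, hlt⟩ := hlt
      have hc := ((exists_connectsIn_iff hL).1 hU).mono U.2 (U := T + 1 / ((n : ℝ) + 1))
        (by exact_mod_cast (ENNReal.coe_lt_coe.1 hlt).le)
      exact hc.withBackground 0
    refine hL.connectedIn_of_tendsto ?_ (fun n => by positivity) tendsto_const_nhds
      (fun _ => zero_le_one) hex
    simpa using (tendsto_one_div_add_atTop_nhds_zero_nat (𝕜 := ℝ)).const_add (T : ℝ)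
  · intro h
    exact iInf₂_le T ((exists_connectsIn_iff hL).2 h)

/-- For a tame pattern in which all points are connected, the transit time is a geodesic metric,
and `Π`-geodesics exist and are geodesics of this metric. -/
theorem IsTame.geodesic (hL : IsTame (silhouette L))
    (hconn : ∀ x y, ∃ T : ℝ≥0, ConnectedIn (silhouette L) T x y) :
    (∀ x y : Space d, ∃ (T : ℝ≥0) (ξ : ℝ → Space d), ConnectsIn L x y T ξ) ∧
      IsGeodesicMetric (transitTime L) ∧
      (∀ x y : Space d, ∃ (T : ℝ≥0) (ξ : ℝ → Space d), IsPiGeodesic L x y T ξ) ∧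
      (∀ (x y : Space d) (T : ℝ≥0) (ξ : ℝ → Space d), IsPiGeodesic L x y T ξ →
        IsMetricGeodesic (transitTime L) x y T ξ) := by
  have hfin : ∀ x y, ∃ T : ℝ≥0, transitTime L x y = T := by
    intro x y
    obtain ⟨T, hT⟩ := hconn x y
    have := (transitTime_le_iff hL).2 hT
    exact ⟨_, (ENNReal.coe_toNNReal (this.trans_lt ENNReal.coe_lt_top).ne).symm⟩
  have hpath : ∀ {x y} {T : ℝ≥0}, transitTime L x y = T → ConnectedIn (silhouette L) T x y :=
    fun h => (transitTime_le_iff hL).1 h.le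
  have hsymm : ∀ x y, transitTime L x y ≤ transitTime L y x := by
    intro x y
    obtain ⟨T, hT⟩ := hfin y x
    rw [hT, transitTime_le_iff hL]
    exact (hpath hT).symm
  have htri : ∀ x y z, transitTime L x z ≤ transitTime L x y + transitTime L y z := by
    intro x y z
    obtain ⟨T, hT⟩ := hfin x y
    obtain ⟨U, hU⟩ := hfin y z
    rw [hT, hU, ← ENNReal.coe_add, transitTime_le_iff hL]
    exact (hpath hT).trans (hpath hU) T.2 U.2
  have hgeo : ∀ x y, ∃ (T : ℝ≥0) (ξ : ℝ → Space d), IsPiGeodesic L x y T ξ := by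
    intro x y
    obtain ⟨T, hT⟩ := hfin x y
    obtain ⟨ξ, hξ⟩ := (exists_connectsIn_iff hL).2 (hpath hT)
    refine ⟨T, ξ, hξ, fun U hU hη => ?_⟩
    have := (transitTime_le_iff hL).2 ((exists_connectsIn_iff hL).1 hη)
    rw [hT, ENNReal.coe_le_coe] at this
    exact this.not_gt hU
  have hmet : ∀ (x y : Space d) (T : ℝ≥0) (ξ : ℝ → Space d), IsPiGeodesic L x y T ξ →
      IsMetricGeodesic (transitTime L) x y T ξ := by
    rintro x y T ξ ⟨hξ, hmin⟩
    obtain ⟨hc, h0, hT⟩ := (connectsIn_iff hL).1 hξ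
    have hle : ∀ a ∈ Icc 0 (T : ℝ), ∀ b ∈ Icc 0 (T : ℝ), a ≤ b →
        transitTime L (ξ a) (ξ b) ≤ ENNReal.ofReal (b - a) := by
      intro a ha b hb hab
      rw [ENNReal.ofReal, transitTime_le_iff hL, Real.coe_toNNReal _ (by linarith)]
      exact hc.connectedIn ha hb
    have hge : (T : ℝ≥0∞) ≤ transitTime L x y := by
      obtain ⟨U, hU⟩ := hfin x y
      rw [hU, ENNReal.coe_le_coe]
      by_contra! hlt
      exact hmin U hlt ((exists_connectsIn_iff hL).2 (hpath hU))
    -- If a part of the geodesic could be shortened, so could the whole.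
    have heq : ∀ a ∈ Icc 0 (T : ℝ), ∀ b ∈ Icc 0 (T : ℝ), a ≤ b →
        transitTime L (ξ a) (ξ b) = ENNReal.ofReal (b - a) := by
      intro a ha b hb hab
      refine le_antisymm (hle a ha b hb hab) ?_
      have hzero : (0 : ℝ) ∈ Icc 0 (T : ℝ) := ⟨le_rfl, T.2⟩
      have hlast : (T : ℝ) ∈ Icc 0 (T : ℝ) := ⟨T.2, le_rfl⟩
      have h1 := hle 0 hzero a ha ha.1
      have h2 := hle b hb T hlast hb.2
      have h3 := htri (ξ 0) (ξ a) (ξ T)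
      have h4 := htri (ξ a) (ξ b) (ξ T)
      rw [h0, hT] at h3
      rw [h0] at h1
      rw [hT] at h2 h4
      obtain ⟨u, hu⟩ := hfin (ξ a) (ξ b)
      rw [hu] at h4 ⊢
      have hsum : (T : ℝ≥0∞) ≤ ENNReal.ofReal (a - 0) + (u + ENNReal.ofReal (T - b)) :=
        hge.trans (h3.trans (add_le_add h1 (h4.trans (add_le_add le_rfl h2))))
      rw [← ENNReal.ofReal_coe_nnreal (p := u), ← ENNReal.ofReal_coe_nnreal (p := T),
        ← ENNReal.ofReal_add u.coe_nonneg (by linarith [hb.2]),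
        ← ENNReal.ofReal_add (by linarith [ha.1]) (by have := u.coe_nonneg; linarith [hb.2]),
        ENNReal.ofReal_le_ofReal_iff (by have := u.coe_nonneg; linarith [hb.2, ha.1])] at hsum
      rw [← ENNReal.ofReal_coe_nnreal (p := u)]
      exact ENNReal.ofReal_le_ofReal (by linarith)
    refine ⟨h0, hT, fun s hs t ht => ?_⟩
    rcases le_total s t with hst | hst
    · rw [heq s hs t ht hst, abs_sub_comm, abs_of_nonneg (by linarith)]
    · rw [le_antisymm (hsymm _ _) (hsymm _ _), heq t ht s hs hst, abs_of_nonneg (by linarith)]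
  refine ⟨fun x y => ?_, ⟨⟨fun x y => ?_, fun x y => ⟨fun h => ?_, ?_⟩,
    fun x y => le_antisymm (hsymm x y) (hsymm y x), htri⟩, fun x y => ?_⟩, hgeo, hmet⟩
  · obtain ⟨T, ξ, h, -⟩ := hgeo x y
    exact ⟨T, ξ, h⟩
  · obtain ⟨T, hT⟩ := hfin x y
    rw [hT]
    exact ENNReal.coe_ne_top
  · obtain ⟨f, -, h0, h1⟩ := hpath (T := 0) (by simpa using h)
    rw [← h0, ← h1, NNReal.coe_zero]
  · rintro rfl
    exact nonpos_iff_eq_zero.1 ((transitTime_le_iff hL (T := 0)).2 (ConnectedIn.refl x))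
  · obtain ⟨T, ξ, h⟩ := hgeo x y
    exact ⟨T, ξ, hmet x y T ξ h⟩

end Tame

/-! ### Connecting points by a hierarchy of lines -/

section Hierarchy

variable {d : ℕ}

/-- Motion along a segment at speed `w` is compliant if the segment is contained in the sets `S v`
with `v ≤ w`. -/
theorem connectedIn_of_segment_subset {S : ℝ → Set (Space d)} {p q : Space d} {w T : ℝ}
    (hT : 0 ≤ T) (hpq : dist p q ≤ w * T)
    (hS : ∀ v, 0 < v → v ≤ w → segment ℝ p q ⊆ S v) : ConnectedIn S T p q := by
  refine ⟨fun t => AffineMap.lineMap p q (t / T), ?_, by simp, ?_⟩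
  · intro v hv s hs t ht δ hδ
    rcases le_or_gt v w with hvw | hvw
    · right
      refine ⟨_, hS v hv hvw ?_, by rw [dist_self]; positivity⟩
      rw [segment_eq_image_lineMap]
      exact mem_image_of_mem _ ⟨div_nonneg ht.1 hT, div_le_one_of_le₀ ht.2 hT⟩
    · left
      rw [dist_lineMap_lineMap, Real.dist_eq, ← sub_div, abs_div, abs_of_nonneg hT]
      rcases hT.eq_or_lt with rfl | hT'
      · simp only [div_zero, zero_mul]
        positivity
      · calc |s - t| / T * dist p q ≤ |s - t| / T * (v * T) := by
              gcongr
              exact hpq.trans (by gcongr)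
          _ = v * |s - t| := by field_simp
          _ < v * |s - t| + δ := by linarith
  · rcases hT.eq_or_lt with rfl | hT'
    · rw [mul_zero] at hpq
      simpa using dist_le_zero.1 hpq
    · simp [div_self hT'.ne']

theorem connectedIn_of_mem_line {L : Set (Line d × ℝ)} {l : Line d} {w : ℝ} (hl : (l, w) ∈ L)
    {p q : Space d} (hp : p ∈ l.points) (hq : q ∈ l.points) {T : ℝ} (hT : 0 ≤ T)
    (hpq : dist p q ≤ w * T) : ConnectedIn (silhouette L) T p q := by
  refine connectedIn_of_segment_subset hT hpq fun v _ hvw x hx => ?_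
  simp only [silhouette, mem_iUnion, mem_ofPred_eq]
  exact ⟨(l, w), ⟨hl, hvw⟩, l.1.convex.segment_subset hp hq hx⟩

/-- At all small scales `α ^ n`, locally uniformly in space, two points at distance at most `α ^ n`
have a common line of speed at least `σ ^ n` which passes both of them within distance
`α ^ (n + 1)`. -/
def HasHierarchy (L : Set (Line d × ℝ)) (α σ : ℝ) : Prop :=
  ∀ M : ℝ, ∃ n₀ : ℕ, ∀ n ≥ n₀, ∀ a b : Space d, ‖a‖ ≤ M → dist a b ≤ α ^ n →
    ∃ l w, (l, w) ∈ L ∧ σ ^ n ≤ w ∧ ∃ p ∈ l.points, ∃ q ∈ l.points,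
      dist a p ≤ α ^ (n + 1) ∧ dist b q ≤ α ^ (n + 1)

/-- With background speed `σ ^ m`, connection times at scale `α ^ n` are at most `K (α / σ) ^ n`
with a constant `K` which does not depend on `m`: a gap at scale `n` is replaced by a ride on a line
and two gaps at scale `n + 1`, and as `2 α < σ` the total time of the rides converges. -/
theorem HasHierarchy.connectedIn_withBackground {L : Set (Line d × ℝ)} {α σ M : ℝ} {n₀ : ℕ}
    (hα : 0 < α) (hασ : 2 * α < σ) (hσ : σ < 1)
    (hn₀ : ∀ n ≥ n₀, ∀ a b : Space d, ‖a‖ ≤ M → dist a b ≤ α ^ n →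
      ∃ l w, (l, w) ∈ L ∧ σ ^ n ≤ w ∧ ∃ p ∈ l.points, ∃ q ∈ l.points,
        dist a p ≤ α ^ (n + 1) ∧ dist b q ≤ α ^ (n + 1)) (k : ℕ) :
    ∀ n ≥ n₀, ∀ a b : Space d, ‖a‖ ≤ M - 2 * α ^ n → dist a b ≤ α ^ n →
      ConnectedIn (withBackground (σ ^ (n + k)) (silhouette L))
        (3 / (1 - 2 * (α / σ)) * (α / σ) ^ n) a b := by
  have hσ0 : 0 < σ := by linarith
  set η := α / σ with hη
  have hη0 : 0 < η := by positivity
  have hη1 : 0 < 1 - 2 * η := by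
    rw [hη, sub_pos, ← mul_div_assoc, div_lt_one hσ0]
    exact hασ
  set K := 3 / (1 - 2 * η) with hK
  have hK0 : 0 < K := by positivity
  have hK1 : 1 ≤ K := by rw [hK, le_div_iff₀ hη1]; linarith
  have hK2 : K - 2 * K * η = 3 := by rw [hK]; field_simp
  have hαη : ∀ n : ℕ, σ ^ n * η ^ n = α ^ n := fun n => by
    rw [← mul_pow, hη, mul_div_cancel₀ _ hσ0.ne']
  induction k with
  | zero =>
    intro n hn a b ha hab
    refine connectedIn_of_segment_subset (w := σ ^ n) (by positivity) (hab.trans ?_)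
      fun v _ hv x _ => .inl hv
    calc α ^ n = σ ^ n * (1 * η ^ n) := by rw [one_mul, hαη]
      _ ≤ σ ^ n * (K * η ^ n) := by gcongr
  | succ k ih =>
    intro n hn a b ha hab
    have hpow : α ^ (n + 1) = α ^ n * α := pow_succ α n
    have hαn : 0 < α ^ n := by positivity
    have hhalf : 2 * α ^ (n + 1) ≤ α ^ n := by
      rw [hpow]
      have : α ^ n * (2 * α) ≤ α ^ n * 1 := by gcongr; linarith
      linarith
    obtain ⟨l, w, hl, hw, p, hp, q, hq, hap, hbq⟩ := hn₀ n hn a b (by linarith) hab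
    have hb : ‖b‖ ≤ ‖a‖ + α ^ n := by
      have := norm_le_norm_add_norm_sub a b
      rw [← dist_eq_norm] at this
      linarith
    have hpq : dist p q ≤ w * (3 * η ^ n) := by
      have h2 := dist_comm p a
      have h3 : σ ^ n * (3 * η ^ n) ≤ w * (3 * η ^ n) := by gcongr
      have h4 := hαη n
      have h5 : dist p q ≤ dist p a + (dist a b + dist b q) :=
        (dist_triangle p a q).trans (add_le_add_right (dist_triangle a b q) _)
      nlinarith
    have hexp : n + (k + 1) = n + 1 + k := by ring
    rw [hexp]
    have c1 := ih (n + 1) (by lia) a p (by linarith) hap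
    have c2 := (connectedIn_of_mem_line hl hp hq (by positivity) hpq).withBackground
      (σ ^ (n + 1 + k))
    have c3 := (ih (n + 1) (by lia) b q (by linarith) hbq).symm
    refine ((c1.trans c2 (by positivity) (by positivity)).trans c3 (by positivity)
      (by positivity)).mono (by positivity) (le_of_eq ?_)
    have : K * η ^ (n + 1) + 3 * η ^ n + K * η ^ (n + 1) = (2 * K * η + 3) * η ^ n := by ring
    rw [this, ← hK2]
    ring

/-- The times in which a hierarchy of lines connects two points, with vanishing background speed,
are bounded. Compactness removes the background. -/
theorem HasHierarchy.exists_connectedIn {L : Set (Line d × ℝ)} (hL : IsTame (silhouette L))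
    {α σ : ℝ} (hα : 0 < α) (hασ : 2 * α < σ) (hσ : σ < 1) (h : HasHierarchy L α σ)
    (x y : Space d) : ∃ T : ℝ≥0, ConnectedIn (silhouette L) T x y := by
  obtain ⟨n₀, hn₀⟩ := h (max ‖x‖ ‖y‖ + 2)
  have hσ0 : 0 < σ := by linarith
  have hη1 : 0 < 1 - 2 * (α / σ) := by
    rw [sub_pos, ← mul_div_assoc, div_lt_one hσ0]
    exact hασ
  set C := 3 / (1 - 2 * (α / σ)) * (α / σ) ^ n₀ with hC
  have hC0 : 0 ≤ C := by positivity
  obtain ⟨J, hJ⟩ := exists_nat_gt (dist x y / α ^ n₀)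
  have hJ0 : (0 : ℝ) < J := lt_of_le_of_lt (by positivity) hJ
  rw [div_lt_iff₀ (by positivity)] at hJ
  have hα1 : α ^ n₀ ≤ 1 := pow_le_one₀ hα.le (by linarith)
  -- The segment from `x` to `y` is cut into `J` steps of length at most `α ^ n₀`.
  have hchain : ∀ (k j : ℕ), j ≤ J → ConnectedIn (withBackground (σ ^ (n₀ + k)) (silhouette L))
      (j * C) x (AffineMap.lineMap x y ((j : ℝ) / J)) := by
    intro k j
    induction j with
    | zero => intro _; simpa using ConnectedIn.refl x
    | succ j ih =>
      intro hj
      have hj' : (j : ℝ) / J ∈ Icc (0 : ℝ) 1 :=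
        ⟨by positivity, div_le_one_of_le₀ (by exact_mod_cast (by lia : j ≤ J)) hJ0.le⟩
      have hnorm : ‖AffineMap.lineMap x y ((j : ℝ) / J)‖ ≤ max ‖x‖ ‖y‖ := by
        have := (convexOn_norm (E := Space d) convex_univ).le_on_segment (mem_univ x) (mem_univ y)
          (z := AffineMap.lineMap x y ((j : ℝ) / J))
          (by rw [segment_eq_image_lineMap]; exact mem_image_of_mem _ hj')
        exact this
      have hstep := HasHierarchy.connectedIn_withBackground hα hασ hσ hn₀ k n₀ le_rfl
        (AffineMap.lineMap x y ((j : ℝ) / J)) (AffineMap.lineMap x y (((j + 1 : ℕ) : ℝ) / J))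
        (by linarith) (by
          rw [dist_lineMap_lineMap, Real.dist_eq, ← sub_div]
          push_cast
          rw [sub_add_cancel_left, abs_div, abs_neg, abs_one, abs_of_pos hJ0, div_mul_eq_mul_div,
            one_mul, div_le_iff₀ hJ0, mul_comm]
          exact hJ.le)
      have := (ih (by lia)).trans hstep (by positivity) hC0
      convert this using 1
      push_cast
      ring
  refine ⟨⟨J * C, by positivity⟩, ?_⟩
  refine hL.connectedIn_of_tendsto (U := fun _ => J * C) (e := fun k => σ ^ (n₀ + k))
    tendsto_const_nhds (fun _ => by positivity) ?_ (fun k => pow_le_one₀ hσ0.le hσ.le) fun k => ?_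
  · simp_rw [pow_add]
    simpa using (tendsto_pow_atTop_nhds_zero_of_lt_one hσ0.le hσ).const_mul (σ ^ n₀)
  · have := hchain k J le_rfl
    rwa [div_self hJ0.ne', AffineMap.lineMap_apply_one] at this

end Hierarchy

/-! ### The measure of the lines that hit a ball -/

section LineMeasure

variable {d : ℕ}

/-- The marked lines of speed at least `v` which hit the open ball of centre `z` and radius `r` and
have a direction in `C`. -/
def hitting (z : Space d) (r : ℝ) (C : Set (Directions d)) (v : ℝ) : Set (Line d × ℝ) :=
  ((fun p : Space d × Directions d => Line.through p.1 p.2) '' (Metric.ball z r ×ˢ C)) ×ˢ Ici v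

theorem Line.self_mem_points_through (x : Space d) (u : Directions d) :
    x ∈ (Line.through x u).points :=
  Line.mem_points_through.2 ⟨0, by simp⟩

theorem Line.exists_eq_through (l : Line d) {x : Space d} (hx : x ∈ l.points) :
    ∃ u, l = Line.through x u := by
  obtain ⟨l, hl⟩ := l
  obtain ⟨w, hw0, hw⟩ := finrank_eq_one_iff'.1 hl
  have hw0' : (w : Space d) ≠ 0 := by simpa using hw0
  have hn : ‖(w : Space d)‖ ≠ 0 := norm_ne_zero_iff.2 hw0'
  refine ⟨⟨(‖(w : Space d)‖)⁻¹ • (w : Space d), ?_⟩, Subtype.ext ?_⟩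
  · rw [mem_sphere_zero_iff_norm, norm_smul, norm_inv, norm_norm, inv_mul_cancel₀ hn]
  · have hdir : l.direction = Submodule.span ℝ {(‖(w : Space d)‖)⁻¹ • (w : Space d)} := by
      rw [Submodule.span_singleton_smul_eq (isUnit_iff_ne_zero.2 (inv_ne_zero hn))]
      refine le_antisymm (fun y hy => ?_) ?_
      · obtain ⟨c, hc⟩ := hw ⟨y, hy⟩
        exact Submodule.mem_span_singleton.2 ⟨c, congrArg Subtype.val hc⟩
      · rw [Submodule.span_singleton_le_iff_mem]
        exact w.2
    have hx' : x ∈ l := hx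
    simp only [Line.through]
    rw [← hdir, AffineSubspace.mk'_eq hx']

theorem Line.through_eq_through_iff {x x' : Space d} {u u' : Directions d} :
    Line.through x' u' = Line.through x u ↔
      ∃ r : ℝ, x' = x + r • (u : Space d) ∧ (u' = u ∨ u' = -u) := by
  constructor
  · intro h
    have hx : x' ∈ (Line.through x u).points := h ▸ Line.self_mem_points_through x' u'
    obtain ⟨r, hr⟩ := Line.mem_points_through.1 hx
    refine ⟨r, hr, ?_⟩
    have hy : x' + (1 : ℝ) • (u' : Space d) ∈ (Line.through x u).points :=
      h ▸ Line.mem_points_through.2 ⟨1, rfl⟩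
    obtain ⟨s, hs⟩ := Line.mem_points_through.1 hy
    have hu : (u' : Space d) = (s - r) • (u : Space d) := by
      rw [sub_smul, ← add_right_inj x', ← one_smul ℝ (u' : Space d), hs, hr]
      abel
    have hn := congrArg norm hu
    rw [norm_smul, norm_eq_of_mem_sphere, norm_eq_of_mem_sphere, mul_one, Real.norm_eq_abs] at hn
    rcases eq_or_eq_neg_of_abs_eq hn.symm with h1 | h1
    · left; apply Subtype.ext; rw [hu, h1, one_smul]
    · right; apply Subtype.ext; rw [hu, h1, neg_one_smul]; rfl
  · rintro ⟨r, rfl, h⟩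
    have h1 : Line.through (x + r • (u : Space d)) u = Line.through x u := by
      rw [add_comm]
      exact Line.through_add_smul x u (Submodule.mem_span_singleton.2 ⟨r, rfl⟩)
    rcases h with rfl | rfl
    · exact h1
    · rw [← h1]
      apply Subtype.ext
      simp only [Line.through]
      congr 1
      rw [show ((-u : Directions d) : Space d) = (-1 : ℝ) • (u : Space d) by simp]
      exact Submodule.span_singleton_smul_eq (isUnit_neg_one) (u : Space d)

theorem Line.measurableSet_image_through {U : Set (Space d × Directions d)} (hU : IsOpen U) :
    MeasurableSet ((fun p : Space d × Directions d => Line.through p.1 p.2) '' U) := by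
  change MeasurableSet ((fun p : Space d × Directions d => Line.through p.1 p.2) ⁻¹' _)
  have hset : (fun p : Space d × Directions d => Line.through p.1 p.2) ⁻¹'
      ((fun p : Space d × Directions d => Line.through p.1 p.2) '' U) =
      ⋃ r : ℝ, (fun p : Space d × Directions d => (p.1 + r • (p.2 : Space d), p.2)) ⁻¹' U ∪
        (fun p : Space d × Directions d => (p.1 + r • (p.2 : Space d), -p.2)) ⁻¹' U := by
    ext ⟨x, u⟩
    simp only [mem_preimage, mem_image, Prod.exists, mem_iUnion, mem_union,
      Line.through_eq_through_iff]
    constructor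
    · rintro ⟨x', u', hU', r, rfl, rfl | rfl⟩
      · exact ⟨r, .inl hU'⟩
      · exact ⟨r, .inr hU'⟩
    · rintro ⟨r, h | h⟩
      · exact ⟨_, _, h, r, rfl, .inl rfl⟩
      · exact ⟨_, _, h, r, rfl, .inr rfl⟩
  rw [hset]
  refine (isOpen_iUnion fun r => ?_).measurableSet
  have hc : Continuous fun p : Space d × Directions d => p.1 + r • (p.2 : Space d) := by fun_prop
  exact (hU.preimage (hc.prodMk continuous_snd)).union
    (hU.preimage (hc.prodMk (continuous_snd.neg)))

theorem measurableSet_hitting (z : Space d) (r : ℝ) {C : Set (Directions d)} (hC : IsOpen C)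
    (v : ℝ) : MeasurableSet (hitting z r C v) :=
  (Line.measurableSet_image_through (Metric.isOpen_ball.prod hC)).prod measurableSet_Ici

theorem volume_ball_orthogonal (hd : 2 ≤ d) (u : Directions d)
    (y : (Submodule.span ℝ {(u : Space d)})ᗮ) (r : ℝ) :
    volume (Metric.ball y r) = ENNReal.ofReal r ^ (d - 1) * kappaPred d := by
  have hfact : Fact (Module.finrank ℝ (Space d) = (d - 1) + 1) :=
    ⟨by rw [finrank_euclideanSpace_fin]; lia⟩
  have hfin : Module.finrank ℝ (Submodule.span ℝ {(u : Space d)})ᗮ = d - 1 :=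
    Submodule.finrank_orthogonal_span_singleton (ne_zero_of_mem_unit_sphere u)
  have : Nontrivial (Submodule.span ℝ {(u : Space d)})ᗮ :=
    Module.nontrivial_of_finrank_pos (R := ℝ) (by rw [hfin]; lia)
  have : Nontrivial (EuclideanSpace ℝ (Fin (d - 1))) :=
    Module.nontrivial_of_finrank_pos (R := ℝ) (by rw [finrank_euclideanSpace_fin]; lia)
  rw [kappaPred, InnerProductSpace.volume_ball, InnerProductSpace.volume_ball, hfin,
    finrank_euclideanSpace_fin]
  simp

theorem kappaPred_ne_zero (d : ℕ) : kappaPred d ≠ 0 :=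
  (Metric.measure_ball_pos volume _ one_pos).ne'

theorem kappaPred_ne_top (d : ℕ) : kappaPred d ≠ ∞ := measure_ball_lt_top.ne

theorem two_mul_kappaPred_inv_mul (d : ℕ) (a b : ℝ≥0∞) :
    (2 * kappaPred d)⁻¹ * (a * kappaPred d * b) = 2⁻¹ * b * a := by
  rw [ENNReal.mul_inv (by simp) (by simp)]
  have := ENNReal.inv_mul_cancel (kappaPred_ne_zero d) (kappaPred_ne_top d)
  calc 2⁻¹ * (kappaPred d)⁻¹ * (a * kappaPred d * b)
      = 2⁻¹ * b * a * ((kappaPred d)⁻¹ * kappaPred d) := by ring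
    _ = _ := by rw [this, mul_one]

/-- The lines with direction in `C` that hit a ball of radius `r` have measure at least a constant
times `r ^ (d - 1)`, by looking at the orthogonal projections of the ball. -/
theorem le_lineMeasure_image_through (hd : 2 ≤ d) (z : Space d) (r : ℝ) {C : Set (Directions d)}
    (hC : IsOpen C) :
    2⁻¹ * (volume : Measure (Space d)).toSphere C * ENNReal.ofReal r ^ (d - 1) ≤
      lineMeasure d ((fun p : Space d × Directions d => Line.through p.1 p.2) ''
        (Metric.ball z r ×ˢ C)) := by
  rw [lineMeasure_apply d (Line.measurableSet_image_through (Metric.isOpen_ball.prod hC)),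
    ← two_mul_kappaPred_inv_mul, ← setLIntegral_const]
  refine mul_le_mul' le_rfl ?_
  refine (lintegral_mono_ae ?_).trans (setLIntegral_le_lintegral C _)
  refine (ae_restrict_mem hC.measurableSet).mono fun u hu => ?_
  have hsplit := Submodule.starProjection_add_starProjection_orthogonal
    (K := Submodule.span ℝ {(u : Space d)}) z
  rw [← volume_ball_orthogonal hd u ((Submodule.span ℝ {(u : Space d)})ᗮ.orthogonalProjectionOnto z) r]
  refine measure_mono fun y hy => ?_
  set w := (Submodule.span ℝ {(u : Space d)}).starProjection z
  refine ⟨(w + y, u), ⟨?_, hu⟩,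
    Line.through_add_smul (y : Space d) u (Submodule.starProjection_apply_mem _ _)⟩
  change dist (y : Space d) ((Submodule.span ℝ {(u : Space d)})ᗮ.starProjection z) < r at hy
  rw [Metric.mem_ball, ← hsplit, dist_add_left]
  exact hy

theorem lineMeasure_image_through_le (hd : 2 ≤ d) (r : ℝ) :
    lineMeasure d ((fun p : Space d × Directions d => Line.through p.1 p.2) ''
        (Metric.ball 0 r ×ˢ univ)) ≤
      2⁻¹ * (volume : Measure (Space d)).toSphere univ * ENNReal.ofReal r ^ (d - 1) := by
  rw [lineMeasure_apply d (Line.measurableSet_image_through (Metric.isOpen_ball.prod isOpen_univ)),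
    ← two_mul_kappaPred_inv_mul, ← lintegral_const]
  gcongr with u
  rw [← volume_ball_orthogonal hd u 0 r]
  refine measure_mono ?_
  rintro y ⟨⟨x, u'⟩, ⟨hx, -⟩, h⟩
  obtain ⟨s, rfl, -⟩ := Line.through_eq_through_iff.1 h
  rw [mem_ball_zero_iff] at hx ⊢
  have horth : inner ℝ (y : Space d) (s • (u : Space d)) = 0 :=
    Submodule.inner_left_of_mem_orthogonal
      (Submodule.smul_mem _ s (Submodule.mem_span_singleton_self _)) y.2
  have hpyth := norm_add_sq_eq_norm_sq_add_norm_sq_real horth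
  refine lt_of_le_of_lt ?_ hx
  change ‖(y : Space d)‖ ≤ ‖(y : Space d) + s • (u : Space d)‖
  nlinarith [norm_nonneg ((y : Space d) + s • (u : Space d)), norm_nonneg (s • (u : Space d)),
    norm_nonneg (y : Space d)]

theorem speedMeasure_Ici {γ v : ℝ} (hγ : 1 < γ) (hv : 0 < v) :
    speedMeasure γ (Ici v) = ENNReal.ofReal (v ^ (1 - γ)) := by
  rw [speedMeasure, withDensity_apply _ measurableSet_Ici,
    Measure.restrict_restrict measurableSet_Ici,
    inter_eq_left.2 (Ici_subset_Ioi.2 hv), setLIntegral_congr Ioi_ae_eq_Ici.symm,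
    ← ofReal_integral_eq_lintegral_ofReal, integral_const_mul,
    integral_Ioi_rpow_of_lt (by linarith) hv]
  · congr 1
    have : 1 - γ ≠ 0 := by linarith
    rw [show -γ + 1 = 1 - γ by ring]
    field_simp
    ring
  · exact (integrableOn_Ioi_rpow_of_lt (by linarith) hv).const_mul _
  · refine (ae_restrict_mem measurableSet_Ioi).mono fun w hw => ?_
    have : 0 < w := hv.trans hw
    have : 0 < γ - 1 := by linarith
    simp only [Pi.zero_apply]
    positivity

/-- The constant in the bounds for the intensity of lines that hit a ball: half the surface measure
of the set `C` of their directions. -/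
noncomputable def directionMass (C : Set (Directions d)) : ℝ :=
  ((volume : Measure (Space d)).toSphere C).toReal / 2

theorem ofReal_directionMass (C : Set (Directions d)) :
    ENNReal.ofReal (directionMass C) = 2⁻¹ * (volume : Measure (Space d)).toSphere C := by
  rw [directionMass, ENNReal.ofReal_div_of_pos two_pos,
    ENNReal.ofReal_toReal (measure_lt_top _ _).ne, ENNReal.ofReal_ofNat, ENNReal.div_eq_inv_mul]

theorem directionMass_nonneg (C : Set (Directions d)) : 0 ≤ directionMass C := by
  rw [directionMass]
  positivity

theorem directionMass_pos {C : Set (Directions d)} (hC : IsOpen C) (hne : C.Nonempty) :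
    0 < directionMass C :=
  half_pos (ENNReal.toReal_pos (hC.measure_pos _ hne).ne' (measure_lt_top _ _).ne)

theorem le_lineIntensity_hitting (hd : 2 ≤ d) {γ : ℝ} (hγ : 1 < γ) (z : Space d) {r v : ℝ}
    (hr : 0 ≤ r) (hv : 0 < v) {C : Set (Directions d)} (hC : IsOpen C) :
    ENNReal.ofReal (directionMass C * r ^ (d - 1) * v ^ (1 - γ)) ≤
      lineIntensity d γ (hitting z r C v) := by
  have : SFinite (speedMeasure γ) := by unfold speedMeasure; infer_instance
  rw [hitting, lineIntensity, Measure.prod_prod, speedMeasure_Ici hγ hv,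
    ENNReal.ofReal_mul (mul_nonneg (directionMass_nonneg C) (by positivity)),
    ENNReal.ofReal_mul (directionMass_nonneg C), ofReal_directionMass, ENNReal.ofReal_pow hr]
  gcongr
  exact le_lineMeasure_image_through hd z r hC

theorem lineIntensity_hitting_le (hd : 2 ≤ d) {γ : ℝ} (hγ : 1 < γ) {r v : ℝ}
    (hr : 0 ≤ r) (hv : 0 < v) :
    lineIntensity d γ (hitting 0 r univ v) ≤
      ENNReal.ofReal (directionMass (univ : Set (Directions d)) * r ^ (d - 1) * v ^ (1 - γ)) := by
  have : SFinite (speedMeasure γ) := by unfold speedMeasure; infer_instance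
  rw [hitting, lineIntensity, Measure.prod_prod, speedMeasure_Ici hγ hv,
    ENNReal.ofReal_mul (mul_nonneg (directionMass_nonneg _) (by positivity)),
    ENNReal.ofReal_mul (directionMass_nonneg _), ofReal_directionMass, ENNReal.ofReal_pow hr]
  gcongr
  exact lineMeasure_image_through_le hd r

theorem mem_hitting_univ {z : Space d} {r v : ℝ} {p : Line d × ℝ} :
    p ∈ hitting z r univ v ↔ (∃ x ∈ p.1.points, dist z x < r) ∧ v ≤ p.2 := by
  refine and_congr_left fun _ => ⟨?_, ?_⟩
  · rintro ⟨⟨x, u⟩, ⟨hx, -⟩, h⟩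
    refine ⟨x, ?_, Metric.mem_ball'.1 hx⟩
    rw [← h]
    exact Line.self_mem_points_through x u
  · rintro ⟨x, hx, hlt⟩
    obtain ⟨u, hu⟩ := p.1.exists_eq_through hx
    exact ⟨(x, u), ⟨Metric.mem_ball'.2 hlt, mem_univ _⟩, hu.symm⟩

theorem inter_hitting_univ_nonempty_iff {L : Set (Line d × ℝ)} {z : Space d} {r v : ℝ} :
    (L ∩ hitting z r univ v).Nonempty ↔ ∃ x ∈ silhouette L v, dist z x < r := by
  constructor
  · rintro ⟨p, hp, h⟩
    obtain ⟨⟨x, hx, hlt⟩, hv⟩ := mem_hitting_univ.1 h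
    refine ⟨x, ?_, hlt⟩
    simp only [silhouette, mem_iUnion, mem_ofPred_eq]
    exact ⟨p, ⟨hp, hv⟩, hx⟩
  · rintro ⟨x, hx, hlt⟩
    simp only [silhouette, mem_iUnion, mem_ofPred_eq] at hx
    obtain ⟨p, ⟨hp, hv⟩, hx⟩ := hx
    exact ⟨p, hp, mem_hitting_univ.2 ⟨⟨x, hx, hlt⟩, hv⟩⟩

end LineMeasure

/-! ### Poisson processes: void probabilities -/

section Poisson

variable {Ω X : Type*} [MeasurableSpace Ω] [MeasurableSpace X] {P : Measure Ω}
  {ν : Measure X} {N : Ω → Set X}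

theorem IsPoissonProcess.measurableSet_inter_eq_empty (hN : IsPoissonProcess P ν N) {B : Set X}
    (hB : MeasurableSet B) : MeasurableSet {ω | N ω ∩ B = ∅} := by
  have : {ω | N ω ∩ B = ∅} = (fun ω => (N ω ∩ B).encard) ⁻¹' {0} := by
    ext ω
    simp
  rw [this]
  exact hN.measurable_count B hB (measurableSet_singleton 0)

theorem IsPoissonProcess.measure_inter_eq_empty (hN : IsPoissonProcess P ν N) {B : Set X}
    (hB : MeasurableSet B) (hfin : ν B ≠ ∞) :
    P {ω | N ω ∩ B = ∅} = ENNReal.ofReal (Real.exp (-(ν B).toReal)) := by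
  have h := hN.count_eq B hB hfin 0
  rw [poissonMeasure_singleton] at h
  simpa [ENNReal.coe_toNNReal_eq_toReal] using h

theorem IsPoissonProcess.measure_inter_eq_empty_le (hN : IsPoissonProcess P ν N) {B : Set X}
    (hB : MeasurableSet B) (hfin : ν B ≠ ∞) {x : ℝ} (hx : ENNReal.ofReal x ≤ ν B) :
    P {ω | N ω ∩ B = ∅} ≤ ENNReal.ofReal (Real.exp (-x)) := by
  rw [hN.measure_inter_eq_empty hB hfin]
  gcongr
  exact (ENNReal.ofReal_le_iff_le_toReal hfin).1 hx

theorem IsPoissonProcess.measure_inter_nonempty_le [IsProbabilityMeasure P]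
    (hN : IsPoissonProcess P ν N) {B : Set X} (hB : MeasurableSet B) {x : ℝ}
    (hx : ν B ≤ ENNReal.ofReal x) (hx0 : 0 ≤ x) :
    P {ω | (N ω ∩ B).Nonempty} ≤ ENNReal.ofReal x := by
  have hfin : ν B ≠ ∞ := (hx.trans_lt ENNReal.ofReal_lt_top).ne
  have hcompl : {ω | (N ω ∩ B).Nonempty} = {ω | N ω ∩ B = ∅}ᶜ := by
    ext ω
    simp [nonempty_iff_ne_empty]
  rw [hcompl, prob_compl_eq_one_sub (hN.measurableSet_inter_eq_empty hB),
    hN.measure_inter_eq_empty hB hfin, ← ENNReal.ofReal_one,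
    ← ENNReal.ofReal_sub _ (Real.exp_nonneg _)]
  refine ENNReal.ofReal_le_ofReal ?_
  have h1 := Real.add_one_le_exp (-(ν B).toReal)
  have h2 := (ENNReal.le_ofReal_iff_toReal_le hfin hx0).1 hx
  linarith

theorem IsPoissonProcess.ae_finite_inter [IsProbabilityMeasure P] (hN : IsPoissonProcess P ν N)
    {B : Set X} (hB : MeasurableSet B) (hfin : ν B ≠ ∞) : ∀ᵐ ω ∂P, (N ω ∩ B).Finite := by
  have hmeas : ∀ n : ℕ, MeasurableSet {ω | (N ω ∩ B).encard = n} := fun n =>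
    hN.measurable_count B hB (measurableSet_singleton (n : ℕ∞))
  have hset : {ω | (N ω ∩ B).Finite} = ⋃ n : ℕ, {ω | (N ω ∩ B).encard = n} := by
    ext ω
    simp only [mem_ofPred_eq, mem_iUnion, ← encard_ne_top_iff, ENat.ne_top_iff_exists, eq_comm]
  have hdisj : Pairwise (Function.onFun Disjoint fun n : ℕ => {ω | (N ω ∩ B).encard = n}) := by
    intro m n hmn
    refine Set.disjoint_left.2 fun ω hm hn => hmn ?_
    exact_mod_cast (hm.symm.trans hn : (m : ℕ∞) = n)
  have hone : P {ω | (N ω ∩ B).Finite} = 1 := by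
    rw [hset, measure_iUnion hdisj hmeas]
    simp_rw [hN.count_eq B hB hfin]
    rw [← measure_iUnion (fun m n hmn => by simpa using hmn) fun n => measurableSet_singleton n,
      iUnion_of_singleton, measure_univ]
  exact (mem_ae_iff_prob_eq_one (hset ▸ MeasurableSet.iUnion hmeas)).2 hone

end Poisson

/-! ### Almost surely the pattern is tame -/

section Tame

variable {d : ℕ} {γ : ℝ} {Ω : Type*} [MeasurableSpace Ω] {P : Measure Ω} [IsProbabilityMeasure P]
  {L : Ω → Set (Line d × ℝ)}

theorem lineIntensity_hitting_ne_top (hd : 2 ≤ d) (hγ : 1 < γ) (z : Space d) (r : ℝ) {v : ℝ}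
    (hv : 0 < v) (C : Set (Directions d)) : lineIntensity d γ (hitting z r C v) ≠ ∞ := by
  refine ((measure_mono ?_).trans_lt ((lineIntensity_hitting_le hd hγ (r := |r| + ‖z‖)
    (by positivity) hv).trans_lt ENNReal.ofReal_lt_top)).ne
  refine prod_mono (image_mono (prod_mono (Metric.ball_subset_ball' ?_) (subset_univ C))) subset_rfl
  rw [dist_zero_right]
  linarith [le_abs_self r]

theorem isClosed_silhouette_of_finite {L : Set (Line d × ℝ)} {v : ℝ}
    (h : ∀ n : ℕ, (L ∩ hitting 0 n univ v).Finite) : IsClosed (silhouette L v) := by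
  refine isClosed_of_closure_subset fun x hx => ?_
  obtain ⟨n, hn⟩ := exists_nat_gt ‖x‖
  set K := ⋃ p ∈ L ∩ hitting (0 : Space d) n univ v, p.1.points with hK
  have hKcl : IsClosed K := (h n).isClosed_biUnion fun p _ =>
    AffineSubspace.closed_of_finiteDimensional p.1.1
  have hsub : Metric.ball 0 n ∩ silhouette L v ⊆ K := by
    rintro y ⟨hyn, hy⟩
    simp only [silhouette, mem_iUnion, mem_ofPred_eq] at hy
    obtain ⟨p, ⟨hp, hv⟩, hyp⟩ := hy
    simp only [hK, mem_iUnion]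
    exact ⟨p, ⟨hp, mem_hitting_univ.2 ⟨⟨y, hyp, Metric.mem_ball'.1 hyn⟩, hv⟩⟩, hyp⟩
  have hxK : x ∈ K := hKcl.closure_subset_iff.2 hsub
    (Metric.isOpen_ball.inter_closure ⟨mem_ball_zero_iff.2 hn, hx⟩)
  simp only [hK, mem_iUnion] at hxK
  obtain ⟨p, ⟨hp, hph⟩, hxp⟩ := hxK
  simp only [silhouette, mem_iUnion, mem_ofPred_eq]
  exact ⟨p, ⟨hp, (mem_hitting_univ.1 hph).2⟩, hxp⟩

/-- The expected number of lines of speed at least `ε R` that hit the ball of radius `R` is of order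
`R ^ (d - γ)`, which tends to zero. -/
theorem tendsto_intensity_hitting (hd : 2 ≤ d) (hγ : (d : ℝ) < γ) (c : ℝ) {ε : ℝ} (hε : 0 < ε) :
    Filter.Tendsto (fun n : ℕ => c * (n : ℝ) ^ (d - 1) * (ε * n) ^ (1 - γ)) Filter.atTop
      (nhds 0) := by
  have h := ((tendsto_rpow_neg_atTop (sub_pos.2 hγ)).comp
    (tendsto_natCast_atTop_atTop (R := ℝ))).const_mul (c * ε ^ (1 - γ))
  rw [mul_zero] at h
  refine h.congr' ?_
  filter_upwards [Filter.eventually_gt_atTop 0] with n hn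
  have hn' : (0 : ℝ) < n := by exact_mod_cast hn
  have hpow : (n : ℝ) ^ (d - 1) = (n : ℝ) ^ ((d : ℝ) - 1) := by
    rw [← Real.rpow_natCast, Nat.cast_sub (by lia), Nat.cast_one]
  rw [Function.comp, hpow, Real.mul_rpow hε.le hn'.le,
    show -(γ - d) = ((d : ℝ) - 1) + (1 - γ) by ring, Real.rpow_add hn']
  ring

theorem IsPoissonProcess.ae_isTame (hd : 2 ≤ d) (hγ : (d : ℝ) < γ)
    (hL : IsPoissonProcess P (lineIntensity d γ) L) : ∀ᵐ ω ∂P, IsTame (silhouette (L ω)) := by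
  have hγ1 : 1 < γ := lt_trans (by exact_mod_cast (by lia : 1 < d)) hγ
  have hfin : ∀ᵐ ω ∂P, ∀ m n : ℕ, (L ω ∩ hitting 0 n univ (1 / ((m : ℝ) + 1))).Finite := by
    simp only [ae_all_iff]
    exact fun m n => hL.ae_finite_inter (measurableSet_hitting 0 n isOpen_univ _)
      (lineIntensity_hitting_ne_top hd hγ1 0 n (by positivity) univ)
  have hsparse : ∀ᵐ ω ∂P, ∀ m k : ℕ, ∃ n > k,
      ¬ (L ω ∩ hitting 0 n univ (1 / ((m : ℝ) + 1) * n)).Nonempty := by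
    simp only [ae_all_iff]
    intro m k
    have hε : 0 < 1 / ((m : ℝ) + 1) := by positivity
    have hlim := ENNReal.tendsto_ofReal (tendsto_intensity_hitting hd hγ
      (directionMass (univ : Set (Directions d))) hε)
    rw [ENNReal.ofReal_zero] at hlim
    rw [ae_iff, ← nonpos_iff_eq_zero]
    refine ge_of_tendsto hlim ?_
    filter_upwards [Filter.eventually_gt_atTop k] with n hn
    have hn0 : (0 : ℝ) < n := by exact_mod_cast (by lia : 0 < n)
    refine (measure_mono fun ω hω => ?_).trans (hL.measure_inter_nonempty_le
      (measurableSet_hitting 0 n isOpen_univ (1 / ((m : ℝ) + 1) * n))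
      (lineIntensity_hitting_le hd hγ1 hn0.le (by positivity)) ?_)
    · simp only [mem_ofPred_eq, not_exists, not_and, not_not] at hω
      exact hω n hn
    · have := directionMass_nonneg (univ : Set (Directions d))
      positivity
  filter_upwards [hfin, hsparse] with ω h1 h2
  refine ⟨silhouette_antitone _, fun v hv => ?_, fun ε hε R₀ => ?_⟩
  · obtain ⟨m, hm⟩ := exists_nat_one_div_lt hv
    exact isClosed_silhouette_of_finite fun n => (h1 m n).subset
      (inter_subset_inter_right _ (prod_mono_right (Ici_subset_Ici.2 hm.le)))
  · obtain ⟨m, hm⟩ := exists_nat_one_div_lt hε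
    obtain ⟨k, hk⟩ := exists_nat_gt R₀
    obtain ⟨n, hn, hempty⟩ := h2 m k
    refine ⟨n, hk.trans (by exact_mod_cast hn), Set.disjoint_left.2 fun x hx hxn => hempty ?_⟩
    refine inter_hitting_univ_nonempty_iff.2 ⟨x, silhouette_antitone _ ?_ hx, ?_⟩
    · exact mul_le_mul_of_nonneg_right hm.le (Nat.cast_nonneg n)
    · exact Metric.mem_ball'.1 hxn

end Tame

/-! ### Almost surely the pattern has a hierarchy of lines -/

/-- A grid in the ball of radius `M` with mesh `1 / Q`. -/
theorem exists_finset_net (d M Q : ℕ) (hM : 0 < M) (hQ : 0 < Q) :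
    ∃ Z : Finset (Space d), Z.card ≤ (3 * M * Q) ^ d ∧
      ∀ a : Space d, ‖a‖ ≤ M → ∃ z ∈ Z, dist a z ≤ d / Q := by
  classical
  have hQ' : (0 : ℝ) < Q := by exact_mod_cast hQ
  set g : (Fin d → ℤ) → Space d := fun k => WithLp.toLp 2 fun i => (k i : ℝ) / Q with hg
  refine ⟨(Fintype.piFinset fun _ => Finset.Icc (-((M * Q : ℕ) : ℤ)) ((M * Q : ℕ) : ℤ)).image g,
    Finset.card_image_le.trans ?_, fun a ha => ?_⟩
  · rw [Fintype.card_piFinset_const, Int.card_Icc]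
    have : 0 < M * Q := Nat.mul_pos hM hQ
    exact Nat.pow_le_pow_left (by rw [mul_assoc]; lia) d
  · refine ⟨g fun i => ⌊a i * Q⌋, Finset.mem_image_of_mem _ (Fintype.mem_piFinset.2 fun i => ?_), ?_⟩
    · have hai : |a i| ≤ M := (by simpa using PiLp.norm_apply_le a i : |a i| ≤ ‖a‖).trans ha
      obtain ⟨h1, h2⟩ := abs_le.1 hai
      rw [Finset.mem_Icc, Int.le_floor]
      constructor
      · push_cast
        have := mul_le_mul_of_nonneg_right h1 hQ'.le
        linarith
      · have h3 : ((⌊a i * Q⌋ : ℤ) : ℝ) ≤ ((M * Q : ℕ) : ℤ) := by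
          push_cast
          exact (Int.floor_le _).trans (mul_le_mul_of_nonneg_right h2 hQ'.le)
        exact_mod_cast h3
    · have hi : ∀ i : Fin d, dist (a i) ((⌊a i * Q⌋ : ℝ) / Q) ≤ 1 / Q := by
        intro i
        rw [Real.dist_eq, abs_of_nonneg (by
          rw [sub_nonneg, div_le_iff₀ hQ']; exact Int.floor_le _), sub_le_iff_le_add, ← add_div,
          le_div_iff₀ hQ']
        linarith [Int.lt_floor_add_one (a i * Q)]
      have hsum : dist a (g fun i => ⌊a i * Q⌋) ^ 2 ≤ (d / Q) ^ 2 := by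
        rw [EuclideanSpace.dist_eq, Real.sq_sqrt (by positivity)]
        calc ∑ i, dist (a i) (g (fun i => ⌊a i * Q⌋) i) ^ 2 ≤ ∑ _i : Fin d, (1 / (Q : ℝ)) ^ 2 :=
              Finset.sum_le_sum fun i _ => pow_le_pow_left₀ dist_nonneg (hi i) 2
          _ = d * (1 / (Q : ℝ)) ^ 2 := by simp
          _ ≤ (d : ℝ) ^ 2 * (1 / (Q : ℝ)) ^ 2 := by
              gcongr
              exact_mod_cast Nat.le_self_pow two_ne_zero d
          _ = (d / Q) ^ 2 := by ring
      exact (pow_le_pow_iff_left₀ dist_nonneg (by positivity) two_ne_zero).1 hsum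

theorem summable_pow_mul_exp_neg {g c ρ : ℝ} (hg : 0 < g) (hc : 0 < c) (hρ : 1 < ρ) :
    Summable fun n : ℕ => g ^ n * Real.exp (-(c * ρ ^ n)) := by
  obtain ⟨k, hk⟩ := pow_unbounded_of_one_lt g hρ
  have hρk : 0 < ρ ^ k := by positivity
  refine Summable.of_nonneg_of_le (fun n => by positivity) (fun n => ?_)
    ((summable_geometric_of_lt_one (r := g / ρ ^ k) (by positivity)
      ((div_lt_one hρk).2 hk)).mul_left (k.factorial / c ^ k))
  have hx : 0 < c * ρ ^ n := by positivity
  have h := Real.pow_div_factorial_le_exp (c * ρ ^ n) hx.le k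
  have hk0 : (0 : ℝ) < k.factorial := by exact_mod_cast k.factorial_pos
  calc g ^ n * Real.exp (-(c * ρ ^ n)) = g ^ n / Real.exp (c * ρ ^ n) := by
        rw [Real.exp_neg, div_eq_mul_inv]
    _ ≤ g ^ n / ((c * ρ ^ n) ^ k / k.factorial) := by gcongr
    _ = k.factorial / c ^ k * (g / ρ ^ k) ^ n := by
        rw [mul_pow, div_pow, ← pow_mul, ← pow_mul, mul_comm k n]
        field_simp

/-- The parameters of the hierarchy. The ratio `1 / N` of successive scales and the ratio `σ` of
the speeds used on them are such that the total time of the rides is finite, and that the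
expected number of suitable lines grows geometrically. Both are possible at once as `d < γ`. -/
theorem exists_hierarchy_parameters {d : ℕ} {γ : ℝ} (hd : 2 ≤ d) (hγ : (d : ℝ) < γ) :
    ∃ (N : ℕ) (σ : ℝ), 2 ≤ N ∧ 2 * (1 / (N : ℝ)) < σ ∧ σ < 1 ∧
      1 < (1 / (N : ℝ)) ^ (d - 1) * σ ^ (1 - γ) := by
  have hd' : (1 : ℝ) < d := by exact_mod_cast (by lia : 1 < d)
  set b := ((d : ℝ) - 1) / (γ - 1) with hb
  have hb0 : 0 < b := div_pos (by linarith) (by linarith)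
  have hb1 : b < 1 := (div_lt_one (by linarith)).2 (by linarith)
  have hlim := (tendsto_rpow_atTop (sub_pos.2 hb1)).comp (tendsto_natCast_atTop_atTop (R := ℝ))
  obtain ⟨N, hN, hN2⟩ := ((hlim.eventually_gt_atTop 2).and (Filter.eventually_ge_atTop 2)).exists
  have hN0 : (0 : ℝ) < N := by exact_mod_cast (by lia : 0 < N)
  have hN1 : (1 : ℝ) ≤ N := by exact_mod_cast (by lia : 1 ≤ N)
  have hlt : 2 * (1 / (N : ℝ)) < (N : ℝ) ^ (-b) := by
    have h1 : (N : ℝ) ^ (1 - b) = N * (N : ℝ) ^ (-b) := by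
      rw [sub_eq_add_neg, Real.rpow_add hN0, Real.rpow_one]
    simp only [Function.comp, h1] at hN
    rw [mul_one_div, div_lt_iff₀ hN0]
    linarith
  obtain ⟨σ, hσ1, hσ2⟩ := exists_between hlt
  have hσ0 : 0 < σ := lt_trans (by positivity) hσ1
  refine ⟨N, σ, hN2, hσ1, hσ2.trans_le (Real.rpow_le_one_of_one_le_of_nonpos hN1 (by linarith)), ?_⟩
  have h2 : ((N : ℝ) ^ (-b)) ^ (1 - γ) < σ ^ (1 - γ) :=
    Real.rpow_lt_rpow_of_neg hσ0 hσ2 (by linarith)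
  have h3 : ((N : ℝ) ^ (-b)) ^ (1 - γ) = (N : ℝ) ^ (d - 1) := by
    rw [← Real.rpow_mul hN0.le, ← Real.rpow_natCast, Nat.cast_sub (by lia), Nat.cast_one]
    congr 1
    rw [hb]
    have : γ - 1 ≠ 0 := by linarith
    field_simp
    ring
  rw [h3] at h2
  calc (1 : ℝ) = (1 / (N : ℝ)) ^ (d - 1) * (N : ℝ) ^ (d - 1) := by
        rw [← mul_pow, one_div_mul_cancel hN0.ne', one_pow]
    _ < _ := by gcongr

section Hierarchy

variable {d : ℕ}

/-- A line that passes near `a`, in a direction close to that of `b - a`, also passes near `b`. -/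
theorem exists_near_points {a b z : Space d} {u e : Directions d} {l : Line d} {x : Space d}
    {ρ δ : ℝ} (hl : Line.through x u = l) (hx : dist x z < ρ * δ) (hz : dist a z ≤ ρ * δ)
    (he : b = a + dist a b • (e : Space d)) (hab : dist a b ≤ δ) (hue : dist e u ≤ 2 * ρ)
    (hρδ : 0 ≤ ρ * δ) :
    ∃ p ∈ l.points, ∃ q ∈ l.points, dist a p ≤ 4 * ρ * δ ∧ dist b q ≤ 4 * ρ * δ := by
  have hax : dist a x ≤ 2 * (ρ * δ) := by
    have := dist_triangle_right a x z
    linarith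
  refine ⟨x, hl ▸ Line.self_mem_points_through x u, x + dist a b • (u : Space d),
    hl ▸ Line.mem_points_through.2 ⟨_, rfl⟩, by linarith, ?_⟩
  have h1 : dist b (x + dist a b • (u : Space d)) ≤ dist a x + dist a b * dist e u := by
    have h3 : dist (dist a b • (e : Space d)) (dist a b • (u : Space d)) = dist a b * dist e u := by
      rw [dist_smul₀, Real.norm_of_nonneg dist_nonneg, Subtype.dist_eq]
    rw [← h3]
    nth_rewrite 1 [he]
    exact dist_add_add_le _ _ _ _
  have h2 : dist a b * dist e u ≤ δ * (2 * ρ) :=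
    mul_le_mul hab hue dist_nonneg (dist_nonneg.trans hab)
  linarith

theorem exists_direction (hd : 2 ≤ d) (a b : Space d) :
    ∃ e : Directions d, b = a + dist a b • (e : Space d) := by
  rcases eq_or_ne a b with rfl | hab
  · have : Nontrivial (Space d) :=
      Module.nontrivial_of_finrank_pos (R := ℝ) (by rw [finrank_euclideanSpace_fin]; lia)
    obtain ⟨e, he⟩ := exists_norm_eq (Space d) zero_le_one
    exact ⟨⟨e, mem_sphere_zero_iff_norm.2 he⟩, by simp⟩
  · have hn : ‖b - a‖ ≠ 0 := norm_ne_zero_iff.2 (sub_ne_zero.2 hab.symm)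
    refine ⟨⟨‖b - a‖⁻¹ • (b - a), ?_⟩, ?_⟩
    · rw [mem_sphere_zero_iff_norm, norm_smul, norm_inv, norm_norm, inv_mul_cancel₀ hn]
    · rw [dist_comm, dist_eq_norm, smul_smul, mul_inv_cancel₀ hn, one_smul, add_sub_cancel]

variable {γ : ℝ} {Ω : Type*} [MeasurableSpace Ω] {P : Measure Ω} {L : Ω → Set (Line d × ℝ)}

/-- Almost surely, for all large `n`, lines of speed at least `σ ^ n` with direction in `C` hit each
of polynomially many balls of radius comparable to `N ^ (- n)`: the void probabilities decay faster
than exponentially. -/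
theorem IsPoissonProcess.ae_eventually_hits (hd : 2 ≤ d) (hγ : 1 < γ)
    (hL : IsPoissonProcess P (lineIntensity d γ) L) {N : ℕ} {σ β : ℝ} (hσ : 0 < σ) (hβ : 0 < β)
    (hN : 0 < N) (hgrow : 1 < (1 / (N : ℝ)) ^ (d - 1) * σ ^ (1 - γ))
    {C : Set (Directions d)} (hC : IsOpen C) (hne : C.Nonempty) {Z : ℕ → Finset (Space d)} {A g : ℝ}
    (hg : 0 < g) (hZ : ∀ n, ((Z n).card : ℝ) ≤ A * g ^ n) :
    ∀ᵐ ω ∂P, ∀ᶠ n in Filter.atTop, ∀ z ∈ Z n,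
      (L ω ∩ hitting z (β * (1 / (N : ℝ)) ^ n) C (σ ^ n)).Nonempty := by
  have hN0 : (0 : ℝ) < N := by exact_mod_cast hN
  have hc : 0 < directionMass C * β ^ (d - 1) := mul_pos (directionMass_pos hC hne) (by positivity)
  set c := directionMass C * β ^ (d - 1) with hcdef
  set ρ := (1 / (N : ℝ)) ^ (d - 1) * σ ^ (1 - γ) with hρ
  have hmass : ∀ n : ℕ, directionMass C * (β * (1 / (N : ℝ)) ^ n) ^ (d - 1) * (σ ^ n) ^ (1 - γ) =
      c * ρ ^ n := by
    intro n
    have h1 : (σ ^ n) ^ (1 - γ) = (σ ^ (1 - γ)) ^ n := (Real.rpow_pow_comm hσ.le _ _).symm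
    rw [h1, hcdef, hρ, mul_pow, mul_pow, ← pow_mul, ← pow_mul, mul_comm n (d - 1)]
    ring
  have hbad : ∀ n, P (⋃ z ∈ Z n, {ω | L ω ∩ hitting z (β * (1 / (N : ℝ)) ^ n) C (σ ^ n) = ∅}) ≤
      ENNReal.ofReal (A * (g ^ n * Real.exp (-(c * ρ ^ n)))) := by
    intro n
    have hone : ∀ z ∈ Z n, P {ω | L ω ∩ hitting z (β * (1 / (N : ℝ)) ^ n) C (σ ^ n) = ∅} ≤
        ENNReal.ofReal (Real.exp (-(c * ρ ^ n))) := by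
      intro z _
      refine hL.measure_inter_eq_empty_le (measurableSet_hitting z _ hC _)
        (lineIntensity_hitting_ne_top hd hγ z _ (by positivity) C) ?_
      rw [← hmass n]
      exact le_lineIntensity_hitting hd hγ z (by positivity) (by positivity) hC
    calc _ ≤ ∑ z ∈ Z n, P {ω | L ω ∩ hitting z (β * (1 / (N : ℝ)) ^ n) C (σ ^ n) = ∅} :=
          measure_biUnion_finset_le _ _
      _ ≤ ∑ _z ∈ Z n, ENNReal.ofReal (Real.exp (-(c * ρ ^ n))) := Finset.sum_le_sum hone
      _ = ENNReal.ofReal ((Z n).card * Real.exp (-(c * ρ ^ n))) := by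
          rw [Finset.sum_const, nsmul_eq_mul, ENNReal.ofReal_mul (Nat.cast_nonneg _),
            ENNReal.ofReal_natCast]
      _ ≤ _ := by
          refine ENNReal.ofReal_le_ofReal ?_
          rw [← mul_assoc]
          exact mul_le_mul_of_nonneg_right (hZ n) (Real.exp_nonneg _)
  have hsum := ((summable_pow_mul_exp_neg hg hc hgrow).mul_left A).tsum_ofReal_ne_top
  have hae := ae_eventually_notMem (ne_top_of_le_ne_top hsum (ENNReal.tsum_le_tsum hbad))
  filter_upwards [hae] with ω hω
  filter_upwards [hω] with n hn z hz
  rw [nonempty_iff_ne_empty]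
  intro hempty
  exact hn (mem_biUnion (x := z) hz hempty)

theorem IsPoissonProcess.exists_ae_hasHierarchy (hd : 2 ≤ d) (hγ : (d : ℝ) < γ)
    (hL : IsPoissonProcess P (lineIntensity d γ) L) :
    ∃ α σ : ℝ, 0 < α ∧ 2 * α < σ ∧ σ < 1 ∧ ∀ᵐ ω ∂P, HasHierarchy (L ω) α σ := by
  have hγ1 : 1 < γ := lt_trans (by exact_mod_cast (by lia : 1 < d)) hγ
  obtain ⟨N, σ, hN, hασ, hσ, hgrow⟩ := exists_hierarchy_parameters hd hγ
  have hN0 : (0 : ℝ) < N := by exact_mod_cast (by lia : 0 < N)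
  have hd0 : (0 : ℝ) < d := by exact_mod_cast (by lia : 0 < d)
  refine ⟨1 / N, σ, by positivity, hασ, hσ, ?_⟩
  have hσ0 : 0 < σ := lt_trans (by positivity) hασ
  -- A ball of radius `β N ^ (- n)` and directions within `2 β` leave room for `4 β = 1 / N`.
  set β : ℝ := 1 / (4 * N) with hβ
  have hβ0 : 0 < β := by positivity
  obtain ⟨F, hFfin, hF⟩ := Metric.totallyBounded_iff.1
    (isCompact_univ (X := Directions d)).totallyBounded β hβ0
  have hnet := fun M n : ℕ => exists_finset_net d (M + 1) (4 * d * N ^ (n + 1)) (by lia)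
    (Nat.mul_pos (by lia) (pow_pos (by lia) _))
  choose Z hZcard hZ using hnet
  have hhit : ∀ᵐ ω ∂P, ∀ M : ℕ, ∀ i ∈ F, ∀ᶠ n in Filter.atTop, ∀ z ∈ Z M n,
      (L ω ∩ hitting z (β * (1 / (N : ℝ)) ^ n) (Metric.ball i β) (σ ^ n)).Nonempty := by
    rw [ae_all_iff]
    intro M
    rw [ae_ball_iff hFfin.countable]
    intro i _
    refine hL.ae_eventually_hits hd hγ1 hσ0 hβ0 (by lia) hgrow Metric.isOpen_ball
      (Metric.nonempty_ball.2 hβ0) (A := (3 * (M + 1) * (4 * d * N)) ^ d) (g := (N : ℝ) ^ d)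
      (by positivity) fun n => ?_
    have : ((Z M n).card : ℝ) ≤ ((3 * (M + 1) * (4 * d * N ^ (n + 1)) : ℕ) : ℝ) ^ d := by
      exact_mod_cast hZcard M n
    refine this.trans (le_of_eq ?_)
    push_cast
    rw [← pow_mul, mul_comm d n, pow_mul, ← mul_pow]
    ring
  filter_upwards [hhit] with ω hω M
  obtain ⟨M', hM'⟩ := exists_nat_ge M
  obtain ⟨n₀, hn₀⟩ := Filter.eventually_atTop.1 ((hFfin.eventually_all).2 (hω M'))
  refine ⟨n₀, fun n hn a b ha hab => ?_⟩
  obtain ⟨z, hz, haz⟩ := hZ M' n a (by push_cast; linarith)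
  obtain ⟨e, he⟩ := exists_direction hd a b
  obtain ⟨i, hi, hei⟩ := mem_iUnion₂.1 (hF (mem_univ e))
  obtain ⟨⟨l, w⟩, hlw, ⟨⟨x, u⟩, ⟨hx, hu⟩, hl⟩, hw⟩ := hn₀ n hn i hi z hz
  have hscale : 4 * β * (1 / (N : ℝ)) ^ n = (1 / (N : ℝ)) ^ (n + 1) := by
    rw [hβ, pow_succ]
    field_simp
  have haz' : dist a z ≤ β * (1 / (N : ℝ)) ^ n := by
    refine haz.trans (le_of_eq ?_)
    rw [hβ, one_div_pow, pow_succ]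
    push_cast
    field_simp
  obtain ⟨p, hp, q, hq, hap, hbq⟩ := exists_near_points hl hx haz' he hab
    (by
      have := dist_triangle_right e u i
      have h1 : dist e i < β := hei
      have h2 : dist u i < β := hu
      linarith) (by positivity)
  rw [hscale] at hap hbq
  exact ⟨l, w, hlw, hw, p, hp, q, hq, hap, hbq⟩

end Hierarchy

/-! ### Measurability of the transit time -/

section Measurability

variable {d : ℕ}

/-- A discrete curve which complies with the pattern `L` at the times `i T / (n + 1)` up to an error
`1 / (n + 1)`, for rational speeds. -/
def IsDiscretePath (L : Set (Line d × ℝ)) (T : ℝ) (n : ℕ) (z : Fin (n + 2) → Space d) : Prop :=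
  ∀ (i j : Fin (n + 2)) (v : {v : ℚ // 0 < v}),
    dist (z i) (z j) < v * |i * (T / (n + 1)) - j * (T / (n + 1))| + 1 / ((n : ℝ) + 1) ∨
      ∃ p ∈ silhouette L v,
        dist (z j) p < v * |i * (T / (n + 1)) - j * (T / (n + 1))| + 1 / ((n : ℝ) + 1)

/-- The discrete curve `z` runs from near `x` to near `y`, inside the ball of radius `R`. -/
def RunsBetween (x y : Space d) (R n : ℕ) (z : Fin (n + 2) → Space d) : Prop :=
  dist (z 0) x ≤ 1 / ((n : ℝ) + 1) ∧ dist (z (Fin.last (n + 1))) y ≤ 1 / ((n : ℝ) + 1) ∧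
    ∀ i, z i ∈ Metric.closedBall 0 R

theorem Compliant.exists_isDiscretePath {L : Set (Line d × ℝ)} {T : ℝ} {f : ℝ → Space d} {R : ℕ}
    (hT : 0 ≤ T) (hf : Compliant (silhouette L) T f)
    (hR : ∀ t ∈ Icc 0 T, f t ∈ Metric.closedBall 0 (R : ℝ)) (n : ℕ) :
    ∃ k : Fin (n + 2) → ℕ, RunsBetween (f 0) (f T) (R + 1) n (TopologicalSpace.denseSeq _ ∘ k) ∧
      IsDiscretePath L T n (TopologicalSpace.denseSeq _ ∘ k) := by
  have hn : (0 : ℝ) < n + 1 := by positivity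
  set e := 1 / ((n : ℝ) + 1) with he
  have he0 : 0 < e := by positivity
  have he1 : e ≤ 1 := by
    rw [he, div_le_one hn]
    linarith [(Nat.cast_nonneg n : (0 : ℝ) ≤ n)]
  have hap : ∀ i : Fin (n + 2), ∃ k : ℕ,
      dist (f (i * (T / (n + 1)))) (TopologicalSpace.denseSeq (Space d) k) < e / 4 := fun i =>
    let ⟨_, hy, k, hk⟩ := Metric.dense_iff.1 (TopologicalSpace.denseRange_denseSeq (Space d))
      (f (i * (T / (n + 1)))) (e / 4) (by positivity)
    ⟨k, by rw [hk, dist_comm]; exact hy⟩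
  choose k hk using hap
  have hmem : ∀ i : Fin (n + 2), (i : ℝ) * (T / (n + 1)) ∈ Icc 0 T := by
    intro i
    refine ⟨by positivity, ?_⟩
    have hi : (i : ℝ) ≤ n + 1 := by exact_mod_cast Nat.lt_succ_iff.1 i.2
    calc (i : ℝ) * (T / (n + 1)) ≤ (n + 1) * (T / (n + 1)) := by gcongr
      _ = T := by field_simp
  refine ⟨k, ⟨?_, ?_, fun i => ?_⟩, fun i j v => ?_⟩
  · have := hk 0
    simp only [Fin.val_zero, Nat.cast_zero, zero_mul] at this
    rw [Function.comp, dist_comm]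
    linarith
  · have := hk (Fin.last (n + 1))
    rw [Fin.val_last, Nat.cast_add, Nat.cast_one, mul_div_cancel₀ _ hn.ne'] at this
    rw [Function.comp, dist_comm]
    linarith
  · have h1 := Metric.mem_closedBall.1 (hR _ (hmem i))
    have h2 := hk i
    have h3 := dist_triangle_left (TopologicalSpace.denseSeq (Space d) (k i)) 0
      (f (i * (T / (n + 1))))
    rw [Metric.mem_closedBall, Function.comp]
    push_cast
    linarith
  · have h1 := hk i
    have h2 := hk j
    simp only [Function.comp]
    rcases hf v (by exact_mod_cast v.2) _ (hmem i) _ (hmem j) (e / 2) (by positivity) with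
      h | ⟨p, hp, h⟩
    · left
      have h3 := dist_triangle4 (TopologicalSpace.denseSeq (Space d) (k i))
        (f (i * (T / (n + 1)))) (f (j * (T / (n + 1)))) (TopologicalSpace.denseSeq (Space d) (k j))
      rw [dist_comm _ (f (i * (T / (n + 1))))] at h3
      linarith
    · right
      refine ⟨p, hp, ?_⟩
      have h3 := dist_triangle_left (TopologicalSpace.denseSeq (Space d) (k j)) p
        (f (j * (T / (n + 1))))
      linarith

/-- Compactness: discrete curves of arbitrarily fine resolution have a compliant limit. -/
theorem connectedIn_of_forall_isDiscretePath {L : Set (Line d × ℝ)} {T : ℝ} (hT : 0 < T) (R : ℕ)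
    {x y : Space d} (h : ∀ n, ∃ z, RunsBetween x y R n z ∧ IsDiscretePath L T n z) :
    ConnectedIn (silhouette L) T x y := by
  choose z hz hpath using h
  set m : ℕ → ℝ → ℕ := fun n t => ⌊t / (T / (n + 1))⌋₊ with hm
  have hstep : ∀ n : ℕ, 0 < T / (n + 1) := fun n => by positivity
  have hmlt : ∀ n, ∀ t ∈ Icc 0 T, m n t < n + 2 := by
    intro n t ht
    have : t / (T / (n + 1)) ≤ (n + 1 : ℕ) := by
      rw [div_le_iff₀ (hstep n)]
      push_cast
      rw [mul_div_cancel₀ _ (by positivity)]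
      exact ht.2
    exact Nat.lt_succ_of_le (Nat.floor_le_of_le this)
  have hmnear : ∀ n, ∀ t ∈ Icc 0 T, |m n t * (T / (n + 1)) - t| ≤ T / (n + 1) := by
    intro n t ht
    have h1 := Nat.floor_le (div_nonneg ht.1 (hstep n).le)
    have h2 := (Nat.lt_floor_add_one (t / (T / (n + 1)))).le
    rw [le_div_iff₀ (hstep n)] at h1
    rw [div_le_iff₀ (hstep n)] at h2
    rw [abs_le]
    constructor <;> simp only [hm] <;> linarith
  set F : ℕ → ℝ → Space d := fun n t => z n (Fin.ofNat (n + 2) (m n t)) with hF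
  have hval : ∀ n, ∀ t ∈ Icc 0 T, ((Fin.ofNat (n + 2) (m n t) : Fin (n + 2)) : ℕ) = m n t :=
    fun n t ht => Nat.mod_eq_of_lt (hmlt n t ht)
  obtain ⟨f, hf, hlim⟩ := exists_compliant_of_approx (S := silhouette L) (T := T) 0 R F
    (fun n t _ => (hz n).2.2 _) (fun v hv s hs t ht δ hδ => by
      obtain ⟨w, hvw, hw⟩ := exists_rat_btwn (show v < v + δ / (2 * T) by
        have : 0 < δ / (2 * T) := by positivity
        linarith)
      have hw0 : (0 : ℝ) < w := hv.trans hvw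
      have hst : |s - t| ≤ T := abs_le.2 ⟨by linarith [hs.1, ht.2], by linarith [hs.2, ht.1]⟩
      have hwst : w * |s - t| ≤ v * |s - t| + δ / 2 := by
        calc w * |s - t| ≤ (v + δ / (2 * T)) * |s - t| := by gcongr
          _ = v * |s - t| + δ / (2 * T) * |s - t| := by ring
          _ ≤ v * |s - t| + δ / (2 * T) * T := by gcongr
          _ = v * |s - t| + δ / 2 := by field_simp
      have hsmall : Filter.Tendsto (fun n : ℕ => (2 * w * T + 1) * (1 / ((n : ℝ) + 1)))
          Filter.atTop (nhds 0) := by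
        simpa using (tendsto_one_div_add_atTop_nhds_zero_nat (𝕜 := ℝ)).const_mul (2 * w * T + 1)
      filter_upwards [hsmall.eventually_lt_const (half_pos hδ)] with n hn
      have hle : w * |m n s * (T / (n + 1)) - m n t * (T / (n + 1))| + 1 / ((n : ℝ) + 1) <
          v * |s - t| + δ := by
        have h1 : |m n s * (T / (n + 1)) - m n t * (T / (n + 1))| ≤ |s - t| + 2 * (T / (n + 1)) := by
          have h2 := abs_le.1 (hmnear n s hs)
          have h3 := abs_le.1 (hmnear n t ht)
          have h4 := abs_le.1 (le_refl |s - t|)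
          rw [abs_le]
          constructor <;> linarith [h2.1, h2.2, h3.1, h3.2, h4.1, h4.2]
        have h5 := mul_le_mul_of_nonneg_left h1 hw0.le
        have h6 : w * (2 * (T / (n + 1))) + 1 / ((n : ℝ) + 1) =
            (2 * w * T + 1) * (1 / ((n : ℝ) + 1)) := by ring
        linarith
      have hp := hpath n (Fin.ofNat (n + 2) (m n s)) (Fin.ofNat (n + 2) (m n t))
        ⟨w, by exact_mod_cast hw0⟩
      rw [hval n s hs, hval n t ht] at hp
      rcases hp with h | ⟨p, hp, h⟩
      · exact .inl (h.trans hle)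
      · exact .inr ⟨p, silhouette_antitone L hvw.le hp, h.trans hle⟩)
  have hend : ∀ (G : ℕ → Space d) (a : Space d), (∀ n, dist (G n) a ≤ 1 / ((n : ℝ) + 1)) →
      Filter.Tendsto G (Filter.hyperfilter ℕ) (nhds a) := fun G a hG =>
    (tendsto_iff_dist_tendsto_zero.2 (squeeze_zero (fun _ => dist_nonneg) hG
      tendsto_one_div_add_atTop_nhds_zero_nat)).mono_left Nat.hyperfilter_le_atTop
  refine ⟨f, hf, tendsto_nhds_unique (hlim 0 ⟨le_rfl, hT.le⟩) (hend _ x fun n => ?_),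
    tendsto_nhds_unique (hlim T ⟨hT.le, le_rfl⟩) (hend _ y fun n => ?_)⟩
  · have : Fin.ofNat (n + 2) (m n 0) = 0 := by simp [hm]
    simp only [hF, this]
    exact (hz n).1
  · have : Fin.ofNat (n + 2) (m n T) = Fin.last (n + 1) := by
      apply Fin.ext
      rw [hval n T ⟨hT.le, le_rfl⟩, Fin.val_last]
      simp only [hm]
      rw [div_div_cancel₀ hT.ne']
      exact_mod_cast Nat.floor_natCast (R := ℝ) (n + 1)
    simp only [hF, this]
    exact (hz n).2.1

/-- For a tame pattern, connections in a positive time are described by countably many conditions on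
discrete curves. -/
theorem IsTame.connectedIn_iff {L : Set (Line d × ℝ)} (hL : IsTame (silhouette L)) {T : ℝ}
    (hT : 0 < T) {x y : Space d} : ConnectedIn (silhouette L) T x y ↔
      ∃ R : ℕ, ∀ n, ∃ k : Fin (n + 2) → ℕ,
        RunsBetween x y R n (TopologicalSpace.denseSeq _ ∘ k) ∧
          IsDiscretePath L T n (TopologicalSpace.denseSeq _ ∘ k) := by
  constructor
  · rintro ⟨f, hf, h0, h1⟩
    obtain ⟨R, hR⟩ := hL.exists_confining_ball x T
    obtain ⟨R', hR'⟩ := exists_nat_ge R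
    subst h0 h1
    refine ⟨R' + 1, hf.exists_isDiscretePath hT.le fun t ht => ?_⟩
    exact Metric.closedBall_subset_closedBall hR'
      (hR 0 zero_le_one T le_rfl f (hf.mono fun v _ p hp => .inr hp) rfl t ht)
  · rintro ⟨R, h⟩
    exact connectedIn_of_forall_isDiscretePath hT R fun n => let ⟨k, hk⟩ := h n; ⟨_, hk⟩

variable {Ω : Type*} [MeasurableSpace Ω] {P : Measure Ω} {L : Ω → Set (Line d × ℝ)}
  {ν : Measure (Line d × ℝ)}

theorem IsPoissonProcess.measurableSet_isDiscretePath (hL : IsPoissonProcess P ν L) (T : ℝ)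
    {n : ℕ} (z : Fin (n + 2) → Space d) : MeasurableSet {ω | IsDiscretePath (L ω) T n z} := by
  have hnear : ∀ (a : Space d) (v r : ℝ),
      MeasurableSet {ω | ∃ p ∈ silhouette (L ω) v, dist a p < r} := by
    intro a v r
    have : {ω | ∃ p ∈ silhouette (L ω) v, dist a p < r} =
        {ω | L ω ∩ hitting a r univ v = ∅}ᶜ := by
      ext ω
      simp only [mem_compl_iff, mem_ofPred_eq, ← nonempty_iff_ne_empty,
        ← inter_hitting_univ_nonempty_iff, ← ne_eq]
    rw [this]
    exact (hL.measurableSet_inter_eq_empty (measurableSet_hitting a r isOpen_univ v)).compl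
  have hset : {ω | IsDiscretePath (L ω) T n z} = ⋂ (i) (j) (v : {v : ℚ // 0 < v}),
      ({_ω | dist (z i) (z j) <
        v * |i * (T / (n + 1)) - j * (T / (n + 1))| + 1 / ((n : ℝ) + 1)} ∪
      {ω | ∃ p ∈ silhouette (L ω) v,
        dist (z j) p < v * |i * (T / (n + 1)) - j * (T / (n + 1))| + 1 / ((n : ℝ) + 1)}) := by
    ext ω
    simp only [mem_iInter, mem_union, mem_ofPred_eq, IsDiscretePath]
  rw [hset]
  exact .iInter fun i => .iInter fun j => .iInter fun v => (MeasurableSet.const _).union (hnear _ _ _)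

theorem IsPoissonProcess.aemeasurable_transitTime (hL : IsPoissonProcess P ν L)
    (htame : ∀ᵐ ω ∂P, IsTame (silhouette (L ω))) (x y : Space d) :
    AEMeasurable (fun ω => transitTime (L ω) x y) P := by
  classical
  set M : ℝ → Set Ω := fun T => ⋃ R : ℕ, ⋂ n : ℕ, ⋃ k : Fin (n + 2) → ℕ,
    {_ω | RunsBetween x y R n (TopologicalSpace.denseSeq _ ∘ k)} ∩
      {ω | IsDiscretePath (L ω) T n (TopologicalSpace.denseSeq _ ∘ k)} with hM
  have hMmeas : ∀ T, MeasurableSet (M T) := fun T =>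
    .iUnion fun R => .iInter fun n => .iUnion fun k =>
      (MeasurableSet.const _).inter (hL.measurableSet_isDiscretePath T _)
  have hMiff : ∀ ω, IsTame (silhouette (L ω)) → ∀ T, 0 < T →
      (ω ∈ M T ↔ ConnectedIn (silhouette (L ω)) T x y) := by
    intro ω hω T hT
    simp only [hM, hω.connectedIn_iff hT, mem_iUnion, mem_iInter, mem_inter_iff, mem_ofPred_eq]
  refine ⟨fun ω => ⨅ q : {q : ℚ // 0 < q}, if ω ∈ M q then ENNReal.ofReal q else ∞,
    .iInf fun q => Measurable.ite (hMmeas q) measurable_const measurable_const, ?_⟩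
  filter_upwards [htame] with ω hω
  refine le_antisymm (le_iInf fun q => ?_) (le_of_forall_gt fun c hc => ?_)
  · have hq : (0 : ℝ) < (q : ℚ) := by exact_mod_cast q.2
    split_ifs with hmem
    · rw [ENNReal.ofReal, transitTime_le_iff hω, Real.coe_toNNReal _ hq.le]
      exact (hMiff ω hω _ hq).1 hmem
    · exact le_top
  · obtain ⟨q, -, hlt, hqc⟩ := ENNReal.lt_iff_exists_rat_btwn.1 hc
    have hq : (0 : ℝ) < q := by
      by_contra! hle
      rw [Real.toNNReal_of_nonpos hle] at hlt
      simp at hlt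
    have hconn := (transitTime_le_iff hω).1 hlt.le
    rw [Real.coe_toNNReal _ hq.le] at hconn
    refine lt_of_le_of_lt (iInf_le _ ⟨q, by exact_mod_cast hq⟩) ?_
    rw [if_pos ((hMiff ω hω _ hq).2 hconn)]
    exact hqc

end Measurability

theorem mainTheorem4 (d : ℕ) (γ : ℝ) (hd : 2 ≤ d) (hγ : (d : ℝ) < γ)
    {Ω : Type*} [MeasurableSpace Ω] (P : Measure Ω) [IsProbabilityMeasure P]
    (L : Ω → Set (Line d × ℝ)) (hL : IsPoissonProcess P (lineIntensity d γ) L) :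
    (∀ᵐ ω ∂P,
      (∀ x y : Space d, ∃ (T : ℝ≥0) (ξ : ℝ → Space d), ConnectsIn (L ω) x y T ξ) ∧
      IsGeodesicMetric (transitTime (L ω)) ∧
      (∀ x y : Space d, ∃ (T : ℝ≥0) (ξ : ℝ → Space d), IsPiGeodesic (L ω) x y T ξ) ∧
      (∀ (x y : Space d) (T : ℝ≥0) (ξ : ℝ → Space d), IsPiGeodesic (L ω) x y T ξ →
        IsMetricGeodesic (transitTime (L ω)) x y T ξ)) ∧
    (∀ x y : Space d, AEMeasurable (fun ω => transitTime (L ω) x y) P) := by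
  have htame := hL.ae_isTame hd hγ
  obtain ⟨α, σ, hα, hασ, hσ, hhier⟩ := hL.exists_ae_hasHierarchy hd hγ
  refine ⟨?_, hL.aemeasurable_transitTime htame⟩
  filter_upwards [htame, hhier] with ω hω hωh
  exact hω.geodesic (hωh.exists_connectedIn hω hα hασ hσ)
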